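/- There are a single algorithm (a program for a random access machine with logarithmic cost) and a function $\varepsilon\colon\mathbb{R}\to(0,1)$ with the following property. Given the adjacency matrix of any simple undirected graph $G$ with vertex set $\{1,\dots,n\}$, the algorithm halts and outputs the chromatic number $\chi(G)$; and for every real number $d$ there are constants $C$ and $k$ (depending only on $d$) such that for all $n$-vertex graphs $G$ of average degree at most $d$ the algorithm uses time at most $C\,(n+1)^k\,(2-\varepsilon(d))^n$, and (exponential) space at most $C\,(n+1)^k\,(2-\varepsilon(d))^n$. In other words, the chromatic number of an $n$-vertex graph of average degree at most $d$ can be computed in $O^*((2-\varepsilon(d))^n)$ time and exponential space, where $\varepsilon(d)>0$ depends only on $d$ and $O^*$ suppresses factors polynomial in $n$. Here the machine has registers and a memory (initially zero apart from the input) holding natural numbers; it supports addition, truncated subtraction, multiplication, integer division, access to memory at computed addresses, conditionals and loops. Each step costs one plus the total bit length of the addresses, operands and results it handles, and time is the total cost. The size of a state is the total bit length of the addresses and contents of all nonzero cells, and space is the maximum over all steps of the size of the current state plus the cost of the step. -/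

import Mathlib

/-! A random access machine on natural numbers with logarithmic cost: registers, a memory with
computed addresses, the four arithmetic operations, and structured control flow.
A program is a fixed finite object that does not depend on the input. -/

namespace RAM

/-- The number of binary digits of `x`, with `bitLen 0 = 1`. -/
def bitLen (x : ℕ) : ℕ := Nat.log 2 x + 1

/-- The contents of the machine. All but finitely many cells hold `0`. -/
structure State where
  reg : ℕ →₀ ℕ
  mem : ℕ →₀ ℕ

/-- The number of bits in a list of all nonzero registers and memory cells, each given by its
address and its content. -/
noncomputable def State.space (s : State) : ℕ :=
  (s.reg.sum fun a v => bitLen a + bitLen v) + (s.mem.sum fun a v => bitLen a + bitLen v)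

/-- Arithmetic operations: addition, truncated subtraction, multiplication, integer division
(with `x / 0 = 0`). -/
inductive Op where
  | add | sub | mul | div

def Op.eval : Op → ℕ → ℕ → ℕ
  | .add, x, y => x + y
  | .sub, x, y => x - y
  | .mul, x, y => x * y
  | .div, x, y => x / y

/-- Expressions: a constant, the content of a register, the content of the memory cell whose
address is the value of an expression, an arithmetic operation. -/
inductive Expr where
  | const (k : ℕ)
  | reg (r : ℕ)
  | mem (a : Expr)
  | op (o : Op) (a b : Expr)

noncomputable def Expr.eval (s : State) : Expr → ℕ
  | .const k => k
  | .reg r => s.reg r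
  | .mem a => s.mem (a.eval s)
  | .op o a b => o.eval (a.eval s) (b.eval s)

/-- Logarithmic cost of evaluating an expression: every operation is charged the total bit length
of the addresses, operands and results that it handles. -/
noncomputable def Expr.cost (s : State) : Expr → ℕ
  | .const k => bitLen k
  | .reg r => bitLen r + bitLen (s.reg r)
  | .mem a => a.cost s + bitLen (a.eval s) + bitLen (s.mem (a.eval s))
  | .op o a b => a.cost s + b.cost s + bitLen (a.eval s) + bitLen (b.eval s)
      + bitLen (o.eval (a.eval s) (b.eval s))

inductive Prog where
  | skip
  /-- Register `r` receives the value of `e`. -/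
  | set (r : ℕ) (e : Expr)
  /-- The memory cell whose address is the value of `a` receives the value of `e`. -/
  | store (a e : Expr)
  | seq (p q : Prog)
  /-- Run `p` if the value of `e` is nonzero, otherwise run `q`. -/
  | ite (e : Expr) (p q : Prog)
  /-- Run `p` as long as the value of `e` is nonzero. -/
  | loop (e : Expr) (p : Prog)

/-- `Exec p s s' t m`: started in state `s`, program `p` halts in state `s'`, after time `t`
and within space `m`. Time is the sum of the costs of all executed steps. Space is the maximum,
over all executed steps, of the size of the state plus the cost of that step, which bounds the
workspace of the step and the size of the new state. -/
inductive Exec : Prog → State → State → ℕ → ℕ → Prop where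
  | skip (s : State) : Exec .skip s s 1 (s.space + 1)
  | set (s : State) (r : ℕ) (e : Expr) (c : ℕ)
      (hc : c = 1 + e.cost s + bitLen r + bitLen (e.eval s)) :
      Exec (.set r e) s ⟨s.reg.update r (e.eval s), s.mem⟩ c (s.space + c)
  | store (s : State) (a e : Expr) (c : ℕ)
      (hc : c = 1 + a.cost s + e.cost s + bitLen (a.eval s) + bitLen (e.eval s)) :
      Exec (.store a e) s ⟨s.reg, s.mem.update (a.eval s) (e.eval s)⟩ c (s.space + c)
  | seq {p q : Prog} {s s₁ s₂ : State} {t₁ t₂ m₁ m₂ : ℕ}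
      (hp : Exec p s s₁ t₁ m₁) (hq : Exec q s₁ s₂ t₂ m₂) :
      Exec (.seq p q) s s₂ (t₁ + t₂) (max m₁ m₂)
  | iteTrue {e : Expr} {p q : Prog} {s s₁ : State} {t m : ℕ}
      (he : e.eval s ≠ 0) (hp : Exec p s s₁ t m) :
      Exec (.ite e p q) s s₁ (1 + e.cost s + t) (max (s.space + (1 + e.cost s)) m)
  | iteFalse {e : Expr} {p q : Prog} {s s₁ : State} {t m : ℕ}
      (he : e.eval s = 0) (hq : Exec q s s₁ t m) :
      Exec (.ite e p q) s s₁ (1 + e.cost s + t) (max (s.space + (1 + e.cost s)) m)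
  | loopDone {e : Expr} {p : Prog} {s : State} (he : e.eval s = 0) :
      Exec (.loop e p) s s (1 + e.cost s) (s.space + (1 + e.cost s))
  | loopStep {e : Expr} {p : Prog} {s s₁ s₂ : State} {t₁ t₂ m₁ m₂ : ℕ}
      (he : e.eval s ≠ 0) (hp : Exec p s s₁ t₁ m₁) (hl : Exec (.loop e p) s₁ s₂ t₂ m₂) :
      Exec (.loop e p) s s₂ (1 + e.cost s + t₁ + t₂)
        (max (s.space + (1 + e.cost s)) (max m₁ m₂))

open Classical in
/-- The input state of a graph on `n` vertices: register `0` holds `n`, and the memory holds the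
adjacency matrix, row by row (cell `i * n + j` is `1` if `i` and `j` are adjacent). Everything else
is `0`. -/
noncomputable def inputState {n : ℕ} (G : SimpleGraph (Fin n)) : State where
  reg := Finsupp.single 0 n
  mem := ∑ i : Fin n, ∑ j : Fin n,
    if G.Adj i j then Finsupp.single ((i : ℕ) * n + (j : ℕ)) 1 else 0

end RAM

open Classical in
/-- The average degree of a graph on `n` vertices (`0` if `n = 0`). -/
noncomputable def avgDegree {n : ℕ} (G : SimpleGraph (Fin n)) : ℝ :=
  (∑ v : Fin n, (G.degree v : ℝ)) / (n : ℝ)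

/-! ### Cost accounting for programs: steps, word length, loops, and space -/

namespace RAM

/-! ### Execution with time measured in steps and values of bounded length -/

/-! The algorithm is inclusion–exclusion over set covers, restricted to a family of vertex sets that
is exponentially smaller than the full power set when the average degree is bounded.

A colouring with least sum of colours gives every vertex a colour at most its degree, so the colours
sum to at most `degSum G`. Hence some colour class is large, of size at least `n * n / (2 * degSum G
+ n)`, and it can be enlarged to a maximal independent set `T`. So `G` is `(k+1)`-colourable iff,
for some such "good" `T`, the complement of `T` is a union of `k` independent sets
(`colorable_succ_iff`). To decide the latter, count `k`-tuples of independent subsets that cover the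
complement. The number of independent subsets of each set comes from a zeta transform (`ind_succ`),
its `k`-th power counts tuples without the covering condition, and a Möbius transform imposes that
condition one vertex at a time (`cov_succ`). Both transforms only pass from `A` to `A.erase v`, so
they can be run on any family closed under taking subsets. The family used, `fam G`, consists of the
subsets of complements of good sets.

It remains to save a factor exponential in `n` in the size of `fam G` (`exists_card_fam_le`). If `S`
misses a maximal independent `T`, then `S` contains no closed neighbourhood, since each one meets
`T`. Many disjoint neighbourhoods of bounded size would therefore give the saving, but vertices of
large degree may be common to many neighbourhoods. So fix a threshold `t` and the set `X` of
vertices of `T` of degree above `t`. A vertex with no neighbour in `X` must have a vertex of `T` of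
degree at most `t` in its closed neighbourhood, so vertices above the threshold can be deleted from
that neighbourhood. A good set has linearly many vertices of bounded degree, none of them adjacent
to `X`. Greedy selection gives order `n / (t+1)` disjoint truncated neighbourhoods, and a saving of
`exp (-c n / (t+1))` for each `X`. There are at most `2 ^ #H` choices of `X`, where `H` is the set
of vertices of degree above `t`. Divergence of the harmonic series gives a `t` in a range depending
only on `d` with `#H * (t+1)` at most a small multiple of `n` (`exists_threshold`), so the saving
wins.

Good sets are enumerated by branching on a vertex that is not isolated, with a search tree of
Fibonacci size, below `1.7 ^ n` up to a constant. Everything is implemented as one program on the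
machine. All numbers have at most `(n+3)^2` bits, so logarithmic cost is a polynomial factor over
the number of steps, and space is at most the input size plus time (`Exec.space_le`). -/

theorem bitLen_pos (x : ℕ) : 1 ≤ bitLen x := Nat.le_add_left _ _

theorem bitLen_le_iff {x W : ℕ} (hW : 1 ≤ W) : bitLen x ≤ W ↔ x < 2 ^ W := by
  unfold bitLen
  rw [Nat.succ_le_iff]
  exact ⟨fun h => Nat.lt_pow_of_log_lt Nat.one_lt_two h, Nat.log_lt_of_lt_pow' (by omega)⟩

theorem lt_two_pow_bitLen (x : ℕ) : x < 2 ^ bitLen x :=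
  Nat.lt_pow_succ_log_self Nat.one_lt_two x

theorem bitLen_le_succ (x : ℕ) : bitLen x ≤ x + 1 :=
  Nat.succ_le_succ (Nat.log_le_self 2 x)

theorem bitLen_mono {x y : ℕ} (h : x ≤ y) : bitLen x ≤ bitLen y :=
  Nat.succ_le_succ (Nat.log_mono_right h)

theorem bitLen_eval_le (o : Op) (x y : ℕ) : bitLen (o.eval x y) ≤ bitLen x + bitLen y := by
  have hx := bitLen_pos x
  have hy := bitLen_pos y
  cases o with
  | add =>
    rw [bitLen_le_iff (by omega)]
    have h1 : 2 ^ bitLen x ≤ 2 ^ (bitLen x + bitLen y - 1) :=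
      Nat.pow_le_pow_right (by norm_num) (by omega)
    have h2 : 2 ^ bitLen y ≤ 2 ^ (bitLen x + bitLen y - 1) :=
      Nat.pow_le_pow_right (by norm_num) (by omega)
    have h3 : 2 ^ (bitLen x + bitLen y) = 2 * 2 ^ (bitLen x + bitLen y - 1) := by
      rw [← pow_succ', Nat.sub_add_cancel (by omega)]
    have := lt_two_pow_bitLen x
    have := lt_two_pow_bitLen y
    simp only [Op.eval]; omega
  | sub => exact (bitLen_mono (Nat.sub_le x y)).trans (by omega)
  | mul =>
    rw [bitLen_le_iff (by omega), pow_add]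
    exact Nat.mul_lt_mul'' (lt_two_pow_bitLen x) (lt_two_pow_bitLen y)
  | div => exact (bitLen_mono (Nat.div_le_self x y)).trans (by omega)

/-- Every register and every memory cell holds at most `W` bits. -/
def Bdd (W : ℕ) (s : State) : Prop := (∀ r, s.reg r < 2 ^ W) ∧ ∀ a, s.mem a < 2 ^ W

/-- The value of an expression has at most `e.wt` times as many bits as the cells it reads. -/
def Expr.wt : Expr → ℕ
  | .const k => k + 1
  | .reg _ => 1
  | .mem _ => 1
  | .op _ a b => a.wt + b.wt

/-- The cost of an expression is at most `e.charge` times the length of the cells it reads. -/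
def Expr.charge : Expr → ℕ
  | .const k => k + 1
  | .reg r => r + 2
  | .mem a => a.charge + a.wt + 1
  | .op _ a b => a.charge + b.charge + 2 * (a.wt + b.wt)

theorem Expr.bitLen_eval_le {W : ℕ} (hW : 1 ≤ W) {s : State} (hs : Bdd W s) (e : Expr) :
    bitLen (e.eval s) ≤ e.wt * W := by
  induction e with
  | const k => exact (bitLen_le_succ k).trans (Nat.le_mul_of_pos_right _ hW)
  | reg r => simpa [Expr.wt, Expr.eval, bitLen_le_iff hW] using hs.1 r
  | mem a _ => simpa [Expr.wt, Expr.eval, bitLen_le_iff hW] using hs.2 _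
  | op o a b iha ihb =>
    simp only [Expr.wt, Expr.eval, add_mul]
    exact (RAM.bitLen_eval_le o _ _).trans (by omega)

theorem Expr.cost_le {W : ℕ} (hW : 1 ≤ W) {s : State} (hs : Bdd W s) (e : Expr) :
    e.cost s ≤ e.charge * W := by
  induction e with
  | const k => exact (bitLen_le_succ k).trans (Nat.le_mul_of_pos_right _ hW)
  | reg r =>
    have h1 := (bitLen_le_iff hW).2 (hs.1 r)
    have h2 := (bitLen_le_succ r).trans (Nat.le_mul_of_pos_right _ hW)
    simp only [Expr.cost, Expr.charge]
    nlinarith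
  | mem a ih =>
    have h1 := (bitLen_le_iff hW).2 (hs.2 (a.eval s))
    have h2 := Expr.bitLen_eval_le hW hs a
    simp only [Expr.cost, Expr.charge]
    nlinarith
  | op o a b iha ihb =>
    have h1 := Expr.bitLen_eval_le hW hs a
    have h2 := Expr.bitLen_eval_le hW hs b
    have h3 := RAM.bitLen_eval_le o (a.eval s) (b.eval s)
    simp only [Expr.cost, Expr.charge]
    nlinarith

noncomputable def State.setR (s : State) (r v : ℕ) : State := ⟨s.reg.update r v, s.mem⟩

noncomputable def State.setM (s : State) (a v : ℕ) : State := ⟨s.reg, s.mem.update a v⟩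

@[simp] theorem State.setR_mem (s : State) (r v : ℕ) : (s.setR r v).mem = s.mem := rfl

@[simp] theorem State.setM_reg (s : State) (r v : ℕ) : (s.setM r v).reg = s.reg := rfl

@[simp] theorem State.setR_reg (s : State) (r v r' : ℕ) :
    (s.setR r v).reg r' = if r' = r then v else s.reg r' := by
  classical
  simp [State.setR, Finsupp.coe_update, Function.update_apply]

@[simp] theorem State.setM_mem (s : State) (a v a' : ℕ) :
    (s.setM a v).mem a' = if a' = a then v else s.mem a' := by
  classical
  simp [State.setM, Finsupp.coe_update, Function.update_apply]

theorem State.ext_iff' {s s' : State} :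
    s = s' ↔ (∀ r, s.reg r = s'.reg r) ∧ ∀ a, s.mem a = s'.mem a := by
  constructor
  · rintro rfl; simp
  · rintro ⟨h1, h2⟩
    cases s; cases s'
    simp only [State.mk.injEq]
    exact ⟨Finsupp.ext h1, Finsupp.ext h2⟩

@[simp] theorem State.setR_setR (s : State) (r v v' : ℕ) :
    (s.setR r v).setR r v' = s.setR r v' := by
  simp only [State.ext_iff', State.setR_reg, State.setR_mem, implies_true, and_true]
  intro r'; split_ifs <;> rfl

theorem State.setR_comm (s : State) {r r' : ℕ} (v v' : ℕ) (h : r ≠ r') :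
    (s.setR r v).setR r' v' = (s.setR r' v').setR r v := by
  simp only [State.ext_iff', State.setR_reg, State.setR_mem, implies_true, and_true]
  intro r''; split_ifs with h1 h2 <;> first | rfl | exact absurd (h2.symm.trans h1) h

@[simp] theorem State.setR_setR_setR (s : State) (r r' v v' w : ℕ) :
    ((s.setR r v).setR r' w).setR r v' = if r = r' then s.setR r v' else (s.setR r' w).setR r v' := by
  split_ifs with h
  · subst h; simp
  · rw [State.setR_comm _ _ _ h, State.setR_setR]

theorem Bdd.setR {W : ℕ} {s : State} (h : Bdd W s) {r v : ℕ} (hv : v < 2 ^ W) :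
    Bdd W (s.setR r v) := by
  refine ⟨fun r' => ?_, h.2⟩
  rw [State.setR_reg]; split_ifs
  · exact hv
  · exact h.1 r'

theorem Bdd.setM {W : ℕ} {s : State} (h : Bdd W s) {r v : ℕ} (hv : v < 2 ^ W) :
    Bdd W (s.setM r v) := by
  refine ⟨h.1, fun r' => ?_⟩
  rw [State.setM_mem]; split_ifs
  · exact hv
  · exact h.2 r'

/-- Started in `s`, with all cells of at most `W` bits, the program `P` halts after at most `T`
steps in a state that satisfies `Q`, and all cells still have at most `W` bits. -/
def Reach (W T : ℕ) (P : Prog) (s : State) (Q : State → Prop) : Prop :=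
  Bdd W s → ∃ s' t m, Exec P s s' t m ∧ t ≤ T * (10000 * W) ∧ Bdd W s' ∧ Q s'

theorem Reach.mono {W T T' : ℕ} {P : Prog} {s : State} {Q Q' : State → Prop}
    (h : Reach W T P s Q) (hT : T ≤ T') (hQ : ∀ s', Q s' → Q' s') : Reach W T' P s Q' := by
  intro hs
  obtain ⟨s', t, m, he, ht, hb, hq⟩ := h hs
  exact ⟨s', t, m, he, ht.trans (Nat.mul_le_mul_right _ hT), hb, hQ _ hq⟩

theorem Reach.seq {W T₁ T₂ T : ℕ} {p q : Prog} {s : State} {Q R : State → Prop}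
    (hp : Reach W T₁ p s Q) (hq : ∀ s', Q s' → Reach W T₂ q s' R) (hT : T₁ + T₂ ≤ T) :
    Reach W T (.seq p q) s R := by
  intro hs
  obtain ⟨s₁, t₁, m₁, he₁, ht₁, hb₁, hq₁⟩ := hp hs
  obtain ⟨s₂, t₂, m₂, he₂, ht₂, hb₂, hq₂⟩ := hq _ hq₁ hb₁
  refine ⟨s₂, _, _, .seq he₁ he₂, ?_, hb₂, hq₂⟩
  calc t₁ + t₂ ≤ (T₁ + T₂) * (10000 * W) := by rw [add_mul]; omega
    _ ≤ _ := Nat.mul_le_mul_right _ hT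

variable {W : ℕ}

theorem Reach.skip (hW : 1 ≤ W) {s : State} {Q : State → Prop} (h : Q s) :
    Reach W 1 .skip s Q :=
  fun hs => ⟨s, _, _, .skip s, by omega, hs, h⟩

/-- A step costs at most a constant, read off from the syntax, times the word length `W`. The number
10000 in `Reach` is a generous common bound for these constants, and `hc` checks it for each
instruction. -/
theorem Reach.set (hW : 1 ≤ W) {s : State} {Q : State → Prop} {r : ℕ} {e : Expr}
    (hc : e.charge + e.wt + r + 2 ≤ 10000) (hv : e.eval s < 2 ^ W) (h : Q (s.setR r (e.eval s))) :
    Reach W 1 (.set r e) s Q := by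
  intro hs
  refine ⟨_, _, _, .set s r e _ rfl, ?_, hs.setR hv, h⟩
  have h1 := e.cost_le hW hs
  have h2 := e.bitLen_eval_le hW hs
  have h3 := bitLen_le_succ r
  nlinarith

theorem Reach.store (hW : 1 ≤ W) {s : State} {Q : State → Prop} {a e : Expr}
    (hc : a.charge + e.charge + a.wt + e.wt + 1 ≤ 10000) (hv : e.eval s < 2 ^ W)
    (h : Q (s.setM (a.eval s) (e.eval s))) :
    Reach W 1 (.store a e) s Q := by
  intro hs
  refine ⟨_, _, _, .store s a e _ rfl, ?_, hs.setM hv, h⟩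
  have h1 := e.cost_le hW hs
  have h2 := e.bitLen_eval_le hW hs
  have h3 := a.cost_le hW hs
  have h4 := a.bitLen_eval_le hW hs
  nlinarith

theorem Expr.test_cost_le (hW : 1 ≤ W) {s : State} (hs : Bdd W s) {e : Expr}
    (hc : e.charge + 1 ≤ 10000) : 1 + e.cost s ≤ 10000 * W := by
  have h1 := e.cost_le hW hs
  nlinarith

theorem Reach.ite (hW : 1 ≤ W) {s : State} {Q : State → Prop} {e : Expr} {p q : Prog} {T : ℕ}
    (hc : e.charge + 1 ≤ 10000) (hp : e.eval s ≠ 0 → Reach W T p s Q)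
    (hq : e.eval s = 0 → Reach W T q s Q) : Reach W (T + 1) (.ite e p q) s Q := by
  intro hs
  have h1 := Expr.test_cost_le hW hs hc
  by_cases he : e.eval s = 0
  · obtain ⟨s', t, m, hx, ht, hb, hQ⟩ := hq he hs
    exact ⟨s', _, _, .iteFalse he hx, by rw [add_mul]; omega, hb, hQ⟩
  · obtain ⟨s', t, m, hx, ht, hb, hQ⟩ := hp he hs
    exact ⟨s', _, _, .iteTrue he hx, by rw [add_mul]; omega, hb, hQ⟩

/-- A loop whose invariant carries a decreasing natural number. -/
theorem Reach.loop (hW : 1 ≤ W) {e : Expr} {p : Prog} {T : ℕ} (hc : e.charge + 1 ≤ 10000)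
    (I : ℕ → State → Prop)
    (step : ∀ m s, I m s → e.eval s ≠ 0 → Reach W T p s fun s' => ∃ m' < m, I m' s')
    (m : ℕ) (s : State) (h : I m s) :
    Reach W ((T + 1) * m + 1) (.loop e p) s fun s' => (∃ m', I m' s') ∧ e.eval s' = 0 := by
  induction m using Nat.strong_induction_on generalizing s with
  | _ m ih =>
    intro hs
    have h1 := Expr.test_cost_le hW hs hc
    by_cases he : e.eval s = 0
    · exact ⟨s, _, _, (.loopDone he), h1.trans (Nat.le_mul_of_pos_left _ (Nat.succ_pos _)), hs, ⟨m, h⟩, he⟩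
    · obtain ⟨s₁, t₁, m₁, hx₁, ht₁, hb₁, m', hm', hI⟩ := step m s h he hs
      obtain ⟨s₂, t₂, m₂, hx₂, ht₂, hb₂, hQ⟩ := ih m' hm' s₁ hI hb₁
      refine ⟨s₂, _, _, .loopStep he hx₁ hx₂, ?_, hb₂, hQ⟩
      have h2 : (T + 1) * m' + (T + 1) ≤ (T + 1) * m := by
        rw [← Nat.mul_succ]; exact Nat.mul_le_mul_left _ hm'
      calc 1 + e.cost s + t₁ + t₂
          ≤ (1 + T + ((T + 1) * m' + 1)) * (10000 * W) := by
            rw [add_mul (1 + T), add_mul 1]; omega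
        _ ≤ _ := Nat.mul_le_mul_right _ (by omega)

/-- For register `r` from `0` up to (excluding) the value of `hi`, run `p`. -/
def forP (r : ℕ) (hi : Expr) (p : Prog) : Prog :=
  .seq (.set r (.const 0)) (.loop (.op .sub hi (.reg r))
    (.seq p (.set r (.op .add (.reg r) (.const 1)))))

/-- `I i` describes the state at the loop test, when the counter already equals `i`. The body must
leave the counter at `i`, and the invariant for `i + 1` is required only after the increment. Each
round costs `T` plus one step for the increment and one for the test. -/
theorem Reach.forP (hW : 1 ≤ W) {r : ℕ} {hi : Expr} {p : Prog} {T : ℕ}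
    (hc : hi.charge + 2 * hi.wt + 2 * r + 100 ≤ 10000) (N : ℕ) (hN : N < 2 ^ W)
    (I : ℕ → State → Prop) (hI : ∀ i ≤ N, ∀ s, I i s → s.reg r = i ∧ hi.eval s = N)
    (step : ∀ i < N, ∀ s, I i s →
      Reach W T p s fun s' => s'.reg r = i ∧ I (i + 1) (s'.setR r (i + 1)))
    {s : State} (h : I 0 (s.setR r 0)) :
    Reach W ((T + 2) * N + 2) (RAM.forP r hi p) s (I N) := by
  refine Reach.seq (T₁ := 1) (T₂ := (T + 2) * N + 1) (Q := fun s => I 0 s)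
    (Reach.set hW (by simp only [Expr.charge, Expr.wt]; omega) (by simp [Expr.eval]) h)
    (fun s hs => ?_) (by omega)
  have key := Reach.loop hW (e := .op .sub hi (.reg r)) (T := T + 1)
    (p := .seq p (.set r (.op .add (.reg r) (.const 1))))
    (by simp only [Expr.charge, Expr.wt]; omega)
    (fun m s => ∃ i ≤ N, m = N - i ∧ I i s) ?_ (N - 0) s ⟨0, Nat.zero_le _, rfl, hs⟩
  · refine key.mono (by simp) ?_
    rintro s' ⟨⟨m, i, hiN, rfl, hIi⟩, he⟩
    obtain ⟨h1, h2⟩ := hI i hiN s' hIi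
    simp only [Expr.eval, Op.eval, h1, h2] at he
    obtain rfl : i = N := by omega
    exact hIi
  · rintro m s ⟨i, hiN, rfl, hIi⟩ he
    obtain ⟨h1, h2⟩ := hI i hiN s hIi
    simp only [Expr.eval, Op.eval, h1, h2] at he
    have hlt : i < N := by omega
    refine (step i hlt s hIi).seq (T₂ := 1) ?_ le_rfl
    rintro s' ⟨hr, hs'⟩
    refine Reach.set hW (by simp only [Expr.charge, Expr.wt]; omega) ?_ ?_
    · simp only [Expr.eval, Op.eval, hr]; omega
    · refine ⟨N - (i + 1), by omega, i + 1, hlt, rfl, ?_⟩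
      simpa only [Expr.eval, Op.eval, hr] using hs'

/-! ### Space is bounded by time -/

/-- A write replaces at most one entry: the old one is erased, and the new one counts only if it is
nonzero. -/
theorem update_sum_le (f : ℕ →₀ ℕ) (a v : ℕ) :
    ((f.update a v).sum fun a v => bitLen a + bitLen v) ≤
      (f.sum fun a v => bitLen a + bitLen v) + (bitLen a + bitLen v) := by
  classical
  have key : ∀ g : ℕ →₀ ℕ, ((g.erase a).sum fun a v => bitLen a + bitLen v) ≤
      g.sum fun a v => bitLen a + bitLen v := by
    intro g
    unfold Finsupp.sum
    rw [Finsupp.support_erase]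
    calc ∑ x ∈ g.support.erase a, (bitLen x + bitLen (g.erase a x))
        = ∑ x ∈ g.support.erase a, (bitLen x + bitLen (g x)) :=
          Finset.sum_congr rfl fun x hx => by
            rw [Finsupp.erase_ne (Finset.ne_of_mem_erase hx)]
      _ ≤ _ := Finset.sum_le_sum_of_subset (Finset.erase_subset _ _)
  by_cases hv : v = 0
  · subst hv
    rw [Finsupp.update_eq_erase_add_single, Finsupp.single_zero, add_zero]
    exact (key f).trans (Nat.le_add_right _ _)
  · unfold Finsupp.sum
    have h0 : insert a f.support = insert a (f.support.erase a) := by grind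
    rw [Finsupp.support_update_ne_zero _ _ hv, h0, Finset.sum_insert (Finset.notMem_erase _ _)]
    have h1 : ∑ x ∈ f.support.erase a, (bitLen x + bitLen (f.update a v x)) =
        ∑ x ∈ f.support.erase a, (bitLen x + bitLen (f x)) :=
      Finset.sum_congr rfl fun x hx => by
        rw [Finsupp.coe_update, Function.update_of_ne (Finset.ne_of_mem_erase hx)]
    have h2 : ∑ x ∈ f.support.erase a, (bitLen x + bitLen (f x)) ≤
        ∑ x ∈ f.support, (bitLen x + bitLen (f x)) :=
      Finset.sum_le_sum_of_subset (Finset.erase_subset _ _)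
    rw [h1, Finsupp.coe_update, Function.update_self]
    beta_reduce
    omega

/-- Each step enlarges the state by at most its own cost, because the cost includes the lengths of
the written address and content. Consequently only time has to be bounded. -/
theorem Exec.space_le {p : Prog} {s s' : State} {t m : ℕ} (h : Exec p s s' t m) :
    s'.space ≤ s.space + t ∧ m ≤ s.space + t := by
  induction h with
  | skip s => simp
  | set s r e c hc =>
    refine ⟨?_, le_rfl⟩
    have := update_sum_le s.reg r (e.eval s)
    simp only [State.space] at *
    omega
  | store s a e c hc =>
    refine ⟨?_, le_rfl⟩
    have := update_sum_le s.mem (a.eval s) (e.eval s)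
    simp only [State.space] at *
    omega
  | seq _ _ ih1 ih2 => omega
  | iteTrue _ _ ih => omega
  | iteFalse _ _ ih => omega
  | loopDone _ => omega
  | loopStep _ _ _ ih1 ih2 => omega

end RAM

/-! ### Combinatorics behind the algorithm: colourings, coverings, branching -/

namespace GraphColoring

open Finset

open scoped Classical

variable {n : ℕ} (G : SimpleGraph (Fin n))

/-- The natural number whose binary digits describe the set `A`. -/
def msk (A : Finset (Fin n)) : ℕ := ∑ v ∈ A, 2 ^ (v : ℕ)

theorem msk_eq_sum_map (A : Finset (Fin n)) : msk A = ∑ i ∈ A.map Fin.valEmbedding, 2 ^ i := by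
  simp [msk]

theorem msk_lt (A : Finset (Fin n)) : msk A < 2 ^ n := by
  rw [msk_eq_sum_map]
  exact Nat.geomSum_lt le_rfl (by simp)

theorem msk_injective : Function.Injective (msk (n := n)) := by
  intro A B h
  rw [msk_eq_sum_map, msk_eq_sum_map] at h
  exact Finset.map_injective _ (geomSum_injective le_rfl h)

/-- Together with the next lemmas this turns set operations into arithmetic: membership is a binary
digit, and removing or adding an element is subtracting or adding a power of two. -/
theorem msk_div_mod (A : Finset (Fin n)) (v : Fin n) :
    msk A / 2 ^ (v : ℕ) % 2 = if v ∈ A then 1 else 0 := by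
  have h : (msk A).testBit v ↔ v ∈ A := by
    rw [← Nat.mem_bitIndices, ← List.mem_toFinset, msk_eq_sum_map,
      toFinset_bitIndices_sum_two_pow]
    simp [Fin.val_inj]
  rw [← Nat.toNat_testBit]
  split_ifs with hv
  · rw [h.2 hv]; rfl
  · rw [Bool.eq_false_iff.2 (fun h' => hv (h.1 h'))]; rfl

theorem msk_erase {A : Finset (Fin n)} {v : Fin n} (h : v ∈ A) :
    msk A - 2 ^ (v : ℕ) = msk (A.erase v) := by
  rw [msk, ← Finset.add_sum_erase _ _ h, Nat.add_sub_cancel_left, msk]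

theorem msk_insert {A : Finset (Fin n)} {v : Fin n} (h : v ∉ A) :
    msk A + 2 ^ (v : ℕ) = msk (insert v A) := by
  rw [msk, msk, Finset.sum_insert h, add_comm]

theorem msk_univ : msk (univ : Finset (Fin n)) = 2 ^ n - 1 := by
  rw [msk, Fin.sum_univ_eq_sum_range (fun i => 2 ^ i), Nat.geomSum_eq le_rfl]
  simp

theorem msk_compl (A : Finset (Fin n)) : 2 ^ n - 1 - msk A = msk Aᶜ := by
  rw [← msk_univ, msk, msk, msk, ← Finset.sum_add_sum_compl A, Nat.add_sub_cancel_left]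

/-! ### Independent sets and colourings -/

/-- No two vertices of `A` are adjacent. -/
def Indep (A : Finset (Fin n)) : Prop := ∀ u ∈ A, ∀ v ∈ A, ¬ G.Adj u v

/-- The number of neighbours of `v`. -/
noncomputable def dg (v : Fin n) : ℕ := #{u | G.Adj v u}

noncomputable def degSum : ℕ := ∑ v, dg G v

/-- Maximal independent sets that are not too small compared to the average degree. -/
def Good (T : Finset (Fin n)) : Prop :=
  Indep G T ∧ (∀ v ∉ T, ¬ Indep G (insert v T)) ∧ n * n ≤ #T * (2 * degSum G + n)

/-- `S` is a union of `k` independent sets. -/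
def Coverable (k : ℕ) (S : Finset (Fin n)) : Prop :=
  ∃ f : Fin k → Finset (Fin n), (∀ j, Indep G (f j) ∧ f j ⊆ S) ∧ ∀ v ∈ S, ∃ j, v ∈ f j

variable {G}

theorem Indep.mono {A B : Finset (Fin n)} (h : Indep G B) (hAB : A ⊆ B) : Indep G A :=
  fun u hu v hv => h u (hAB hu) v (hAB hv)

theorem Indep.exists_maximal {A : Finset (Fin n)} (h : Indep G A) :
    ∃ T, A ⊆ T ∧ Indep G T ∧ ∀ v ∉ T, ¬ Indep G (insert v T) := by
  obtain ⟨T, hAT, hT⟩ := (Set.toFinite {T : Finset (Fin n) | Indep G T}).exists_le_maximal h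
  refine ⟨T, hAT, hT.1, fun v hv hi => hv ?_⟩
  exact hT.2 (y := insert v T) hi (subset_insert _ _) (mem_insert_self _ _)

/-- In a colouring with least sum of colours every vertex sees all smaller colours. -/
theorem exists_coloring_le_dg {k : ℕ} (h : G.Colorable k) :
    ∃ c : G.Coloring (Fin k), ∀ v, (c v : ℕ) ≤ dg G v := by
  obtain ⟨c, -, hc⟩ := WellFounded.has_min
    (measure fun c : G.Coloring (Fin k) => ∑ v, (c v : ℕ)).wf Set.univ ⟨h.some, trivial⟩
  refine ⟨c, fun v => ?_⟩
  by_contra! hv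
  -- If the colour of `v` exceeded its degree, some smaller colour `j` would be absent from the
  -- neighbourhood; recolouring `v` with `j` lowers the sum.
  have h1 : #((univ.filter (G.Adj v)).image fun u => (c u : ℕ)) < #(range (c v)) := by
    rw [card_range]; exact card_image_le.trans_lt hv
  obtain ⟨j, hj, hj'⟩ := exists_mem_notMem_of_card_lt_card h1
  rw [mem_range] at hj
  simp only [mem_image, mem_filter, mem_univ, true_and, not_exists, not_and] at hj'
  let c' : G.Coloring (Fin k) := SimpleGraph.Coloring.mk
    (fun u => if u = v then ⟨j, hj.trans (c v).2⟩ else c u) (by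
      intro a b hab
      split_ifs with h1 h2 h2
      · subst h1; subst h2; exact absurd hab (G.loopless.irrefl _)
      · subst h1; exact fun h => hj' b hab (by rw [← h])
      · subst h2; exact fun h => hj' a hab.symm (by rw [h])
      · exact c.valid hab)
  refine hc c' trivial (show ∑ u, (c' u : ℕ) < ∑ u, (c u : ℕ) from
    sum_lt_sum (fun u _ => ?_) ⟨v, mem_univ _, ?_⟩)
  · change ((if u = v then ⟨j, hj.trans (c v).2⟩ else c u : Fin k) : ℕ) ≤ c u
    split_ifs with h
    · subst h; exact hj.le
    · exact le_rfl
  · change ((if v = v then ⟨j, hj.trans (c v).2⟩ else c v : Fin k) : ℕ) < c v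
    rw [if_pos rfl]; exact hj

/-- If all fibres of `c` have at most `M` elements, the sum of `c` is large. -/
theorem card_sq_le_of_fiber_le {V : Type*} [Fintype V] (c : V → ℕ) (M : ℕ)
    (hM : ∀ j, #{v | c v = j} ≤ M) :
    Fintype.card V * Fintype.card V ≤ M * (2 * ∑ v, c v + Fintype.card V) := by
  have key : ∀ m, #{v | c v < m} ≤ m * M := by
    intro m
    have : univ.filter (fun v => c v < m) = (range m).biUnion fun j => {v | c v = j} := by
      ext v; simp
    rw [this]
    exact (card_biUnion_le_card_mul _ _ M fun j _ => hM j).trans (by simp)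
  -- Every ordered pair satisfies exactly one of `c u ≤ c v` and `c v < c u`. Summing `key` over
  -- both kinds gives `M` times `∑ (c v + 1) + ∑ c u`.
  have h1 : Fintype.card V * Fintype.card V =
      ∑ v, #{u | c u < c v + 1} + ∑ u, #{v | c v < c u} := by
    rw [← card_univ, ← smul_eq_mul, ← sum_const]
    have : ∑ u, #{v | c v < c u} = ∑ v : V, #{u | ¬ c u < c v + 1} := by
      simp only [card_filter]
      rw [sum_comm]
      refine sum_congr rfl fun a _ => sum_congr rfl fun b _ => ?_
      congr 1
      simp only [eq_iff_iff]; omega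
    rw [this, ← sum_add_distrib]
    refine sum_congr rfl fun v _ => ?_
    rw [card_filter_add_card_filter_not]
  rw [h1]
  calc _ ≤ ∑ v, (c v + 1) * M + ∑ u, c u * M :=
        add_le_add (sum_le_sum fun v _ => key _) (sum_le_sum fun v _ => key _)
    _ = _ := by
        rw [← sum_mul, ← sum_mul, sum_add_distrib]
        simp only [sum_const, card_univ, smul_eq_mul, mul_one]; ring

/-- The largest class of a colouring bounded by the degrees meets the size condition of `Good`, and
so does any maximal independent `T` containing it. The other classes, with `T` removed, cover the
complement. Conversely, `T` serves as the last colour, and a vertex covered several times picks one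
of its covering sets. -/
theorem colorable_succ_iff {k : ℕ} :
    G.Colorable (k + 1) ↔ ∃ T, Good G T ∧ Coverable G k Tᶜ := by
  constructor
  · intro h
    obtain ⟨c, hc⟩ := exists_coloring_le_dg h
    obtain ⟨j, -, hj⟩ := exists_max_image (univ : Finset (Fin (k + 1)))
      (fun j => #{v | c v = j}) univ_nonempty
    have hind : ∀ j, Indep G (univ.filter fun v => c v = j) := by
      intro j u hu v hv huv
      simp only [mem_filter, mem_univ, true_and] at hu hv
      exact c.valid huv (hu.trans hv.symm)
    obtain ⟨T, hjT, hT, hmax⟩ := (hind j).exists_maximal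
    have hsq := card_sq_le_of_fiber_le (fun v => (c v : ℕ)) #{v | c v = j} (by
      intro i
      by_cases hi : i < k + 1
      · refine le_trans (le_of_eq ?_) (hj ⟨i, hi⟩ (mem_univ _))
        congr 1; ext v; simp [Fin.ext_iff]
      · rw [filter_false_of_mem]
        · simp
        · intro v _ h; exact hi (h ▸ (c v).2))
    rw [Fintype.card_fin] at hsq
    refine ⟨T, ⟨hT, hmax, hsq.trans ?_⟩, fun i => univ.filter (fun v => c v = j.succAbove i) \ T,
      ?_, ?_⟩
    · refine Nat.mul_le_mul (card_le_card hjT) ?_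
      have : ∑ v, (c v : ℕ) ≤ degSum G := sum_le_sum fun v _ => hc v
      omega
    · intro i
      refine ⟨(hind _).mono sdiff_subset, fun v hv => ?_⟩
      rw [mem_sdiff] at hv
      exact mem_compl.2 hv.2
    · intro v hv
      rw [mem_compl] at hv
      have : c v ≠ j := fun h => hv (hjT (by simp [h]))
      obtain ⟨i, hi⟩ := Fin.exists_succAbove_eq this
      exact ⟨i, by simp [hv, hi]⟩
  · rintro ⟨T, ⟨hT, -, -⟩, f, hf, hcov⟩
    have hch : ∀ v : Fin n, ∃ j : Fin (k + 1),
        (v ∈ T ∧ j = Fin.last k) ∨ ∃ i : Fin k, v ∈ f i ∧ j = i.castSucc := by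
      intro v
      by_cases hv : v ∈ T
      · exact ⟨_, .inl ⟨hv, rfl⟩⟩
      · obtain ⟨i, hi⟩ := hcov v (mem_compl.2 hv)
        exact ⟨_, .inr ⟨i, hi, rfl⟩⟩
    choose c hc using hch
    refine ⟨SimpleGraph.Coloring.mk c ?_⟩
    intro a b hab hcab
    rcases hc a with ⟨ha, hja⟩ | ⟨i, ha, hja⟩ <;> rcases hc b with ⟨hb, hjb⟩ | ⟨i', hb, hjb⟩
    · exact hT a ha b hb hab
    · rw [hcab, hjb] at hja; exact (Fin.castSucc_lt_last i').ne hja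
    · rw [hcab, hjb] at hja; exact (Fin.castSucc_lt_last i).ne hja.symm
    · rw [hcab, hjb] at hja
      obtain rfl := Fin.castSucc_injective _ hja
      exact (hf i').1 a ha b hb hab

/-! ### Counting independent sets and coverings -/

variable (G)

/-- The number of independent subsets of `A` that contain all vertices of `A` from `w` on. -/
noncomputable def ind (w : ℕ) (A : Finset (Fin n)) : ℕ :=
  #{T ∈ A.powerset | Indep G T ∧ ∀ u ∈ A, u ∉ T → (u : ℕ) < w}

/-- The number of `k`-tuples of independent subsets of `A` that cover all vertices of `A` below
`w`. -/
noncomputable def cov (k w : ℕ) (A : Finset (Fin n)) : ℕ :=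
  #{f : Fin k → Finset (Fin n) |
    (∀ j, Indep G (f j) ∧ f j ⊆ A) ∧ ∀ u ∈ A, (u : ℕ) < w → ∃ j, u ∈ f j}

/-- For `w = 0` no vertex of `A` may be missing, so `A` is the only candidate. For `w = n` the
condition is void and all independent subsets are counted. -/
theorem ind_zero (A : Finset (Fin n)) : ind G 0 A = if Indep G A then 1 else 0 := by
  rw [ind]
  have : ∀ T ∈ A.powerset, (Indep G T ∧ ∀ u ∈ A, u ∉ T → (u : ℕ) < 0) ↔ T = A ∧ Indep G A := by
    intro T hT
    rw [mem_powerset] at hT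
    constructor
    · rintro ⟨h1, h2⟩
      obtain rfl : T = A := hT.antisymm fun u hu => by
        by_contra h; exact absurd (h2 u hu h) (Nat.not_lt_zero _)
      exact ⟨rfl, h1⟩
    · rintro ⟨rfl, h⟩
      exact ⟨h, fun u hu hu' => absurd hu hu'⟩
  rw [filter_congr this]
  split_ifs with h
  · rw [card_eq_one]
    exact ⟨A, by ext T; simp [h]; rintro rfl; exact Subset.rfl⟩
  · rw [card_eq_zero, filter_eq_empty_iff]
    exact fun T _ hT => h hT.2

/-- Split by whether the counted set contains `v`: those that do are counted with bound `v`, and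
those that do not are subsets of `A.erase v`. This is one coordinate of the zeta transform. -/
theorem ind_succ (v : Fin n) (A : Finset (Fin n)) :
    ind G (v + 1) A = if v ∈ A then ind G v A + ind G v (A.erase v) else ind G v A := by
  split_ifs with h
  · rw [ind, ind, ind, ← card_union_of_disjoint]
    · congr 1
      ext T
      simp only [mem_filter, mem_union, mem_powerset, mem_erase]
      constructor
      · rintro ⟨h1, h2, h3⟩
        by_cases hv : v ∈ T
        · refine .inl ⟨h1, h2, fun u hu hu' => ?_⟩
          have := h3 u hu hu'
          have : (u : ℕ) ≠ v := fun h => hu' (Fin.ext h ▸ hv)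
          omega
        · refine .inr ⟨fun u hu => mem_erase.2 ⟨fun h => hv (h ▸ hu), h1 hu⟩, h2, ?_⟩
          rintro u ⟨hne, hu⟩ hu'
          have := h3 u hu hu'
          have : (u : ℕ) ≠ v := fun h => hne (Fin.ext h)
          omega
      · rintro (⟨h1, h2, h3⟩ | ⟨h1, h2, h3⟩)
        · exact ⟨h1, h2, fun u hu hu' => (h3 u hu hu').trans (Nat.lt_succ_self _)⟩
        · refine ⟨h1.trans (erase_subset _ _), h2, fun u hu hu' => ?_⟩
          by_cases huv : u = v
          · subst huv; omega
          · exact (h3 u ⟨huv, hu⟩ hu').trans (Nat.lt_succ_self _)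
    · rw [disjoint_left]
      simp only [mem_filter, mem_powerset]
      rintro T ⟨h1, h2, h3⟩ ⟨h4, -, -⟩
      have : v ∉ T := fun hv => notMem_erase v A (h4 hv)
      exact absurd (h3 v h this) (lt_irrefl _)
  · rw [ind, ind]
    congr 1
    refine filter_congr fun T _ => and_congr Iff.rfl
      ⟨fun H u hu hu' => ?_, fun H u hu hu' => (H u hu hu').trans (Nat.lt_succ_self _)⟩
    have := H u hu hu'
    have : (u : ℕ) ≠ v := fun h' => h (Fin.ext h' ▸ hu)
    omega

theorem ind_le (w : ℕ) (A : Finset (Fin n)) : ind G w A ≤ 2 ^ n := by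
  refine (card_filter_le _ _).trans ?_
  rw [card_powerset]
  exact Nat.pow_le_pow_right (by norm_num) ((card_le_univ _).trans (by simp))

theorem cov_zero (k : ℕ) (A : Finset (Fin n)) : cov G k 0 A = ind G n A ^ k := by
  have : (univ.filter fun f : Fin k → Finset (Fin n) =>
      (∀ j, Indep G (f j) ∧ f j ⊆ A) ∧ ∀ u ∈ A, (u : ℕ) < 0 → ∃ j, u ∈ f j) =
      Fintype.piFinset fun _ : Fin k =>
        {T ∈ A.powerset | Indep G T ∧ ∀ u ∈ A, u ∉ T → (u : ℕ) < n} := by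
    ext f
    simp only [mem_filter, mem_univ, true_and, Fintype.mem_piFinset, mem_powerset]
    constructor
    · rintro ⟨h, -⟩ j
      exact ⟨(h j).2, (h j).1, fun u _ _ => u.2⟩
    · intro h
      exact ⟨fun j => ⟨(h j).2.1, (h j).1⟩, fun u _ hu => absurd hu (Nat.not_lt_zero _)⟩
  rw [cov, this, Fintype.card_piFinset]
  simp [ind]

/-- Among the tuples that cover the vertices of `A` below `v`, those leaving `v` uncovered are
exactly the ones inside `A.erase v`. This is one coordinate of the Möbius transform. All
intermediate values are cardinalities, so truncated subtraction is exact and `cov_le` bounds their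
length. -/
theorem cov_succ (k : ℕ) (v : Fin n) (A : Finset (Fin n)) :
    cov G k (v + 1) A = if v ∈ A then cov G k v A - cov G k v (A.erase v) else cov G k v A := by
  split_ifs with h
  · refine (Nat.sub_eq_of_eq_add ?_).symm
    rw [cov, cov, cov, ← card_union_of_disjoint]
    · congr 1
      ext f
      simp only [mem_filter, mem_union, mem_univ, true_and]
      constructor
      · rintro ⟨h1, h2⟩
        by_cases hv : ∃ j, v ∈ f j
        · refine .inl ⟨h1, fun u hu hu' => ?_⟩
          by_cases huv : u = v
          · exact huv ▸ hv
          · have : (u : ℕ) ≠ v := fun h => huv (Fin.ext h)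
            exact h2 u hu (by omega)
        · refine .inr ⟨fun j => ⟨(h1 j).1, fun u hu => mem_erase.2 ⟨?_, (h1 j).2 hu⟩⟩, ?_⟩
          · rintro rfl; exact hv ⟨j, hu⟩
          · intro u hu hu'
            exact h2 u (mem_of_mem_erase hu) hu'
      · rintro (⟨h1, h2⟩ | ⟨h1, h2⟩)
        · exact ⟨h1, fun u hu hu' => h2 u hu (hu'.trans (Nat.lt_succ_self _))⟩
        · refine ⟨fun j => ⟨(h1 j).1, (h1 j).2.trans (erase_subset _ _)⟩, fun u hu hu' => ?_⟩
          exact h2 u (mem_erase.2 ⟨fun h => by subst h; exact lt_irrefl _ hu', hu⟩) hu'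
    · rw [disjoint_left]
      simp only [mem_filter, mem_univ, true_and]
      rintro f ⟨-, h2⟩ ⟨h3, -⟩
      obtain ⟨j, hj⟩ := h2 v h (Nat.lt_succ_self _)
      exact notMem_erase v A ((h3 j).2 hj)
  · rw [cov, cov]
    congr 1
    refine filter_congr fun T _ => and_congr Iff.rfl
      ⟨fun H u hu hu' => H u hu (hu'.trans (Nat.lt_succ_self _)), fun H u hu hu' => ?_⟩
    have : (u : ℕ) ≠ v := fun h' => h (Fin.ext h' ▸ hu)
    exact H u hu (by omega)

theorem cov_le (k w : ℕ) (A : Finset (Fin n)) : cov G k w A ≤ (2 ^ n) ^ k := by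
  refine (card_le_univ _).trans ?_
  simp

theorem cov_ne_zero_iff (k : ℕ) (A : Finset (Fin n)) : cov G k n A ≠ 0 ↔ Coverable G k A := by
  rw [cov, card_ne_zero, filter_nonempty_iff, Coverable]
  simp

/-! ### Branching on a vertex that is not isolated -/

/-- The number of vertices of `T` that have a neighbour in `T`. -/
noncomputable def active (T : Finset (Fin n)) : ℕ := #{v ∈ T | ∃ w ∈ T, G.Adj v w}

/-- A bound for the size of the search tree below `T`. -/
noncomputable def pot (T : Finset (Fin n)) : ℕ := Nat.fib (active G T + 3) - 1

theorem pot_add_one (T : Finset (Fin n)) : pot G T + 1 = Nat.fib (active G T + 3) :=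
  Nat.sub_add_cancel (Nat.fib_pos.2 (by omega))

/-- The shift by 3 in `pot` makes even a leaf of the search tree worth at least 1, so that
processing it lowers the total potential. -/
theorem one_le_pot (T : Finset (Fin n)) : 1 ≤ pot G T := by
  have := Nat.fib_mono (show 3 ≤ active G T + 3 by omega)
  rw [← pot_add_one] at this
  have h3 : Nat.fib 3 = 2 := rfl
  omega

theorem pot_le (T : Finset (Fin n)) : pot G T ≤ Nat.fib (n + 3) := by
  refine (Nat.sub_le _ _).trans (Nat.fib_mono ?_)
  have : active G T ≤ n := (card_le_univ _).trans (by simp)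
  omega

variable {G}

/-- Deleting `v` loses at least one active vertex. Deleting the neighbours of `v` loses at least
two: `w` disappears and `v` becomes isolated. Since `pot + 1` is a Fibonacci number, the recurrence
applies, and the subtracted 1 pays for the branching node. -/
theorem pot_branch {T : Finset (Fin n)} {v w : Fin n} (hv : v ∈ T) (hw : w ∈ T) (h : G.Adj v w) :
    pot G (T.erase v) + pot G (T.filter fun u => ¬ G.Adj v u) + 1 ≤ pot G T := by
  have h1 : active G (T.erase v) + 1 ≤ active G T := by
    refine Nat.succ_le_of_lt (card_lt_card ⟨?_, fun H => ?_⟩)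
    · intro u hu
      simp only [mem_filter, mem_erase] at hu ⊢
      obtain ⟨⟨-, h1⟩, x, ⟨-, h2⟩, h3⟩ := hu
      exact ⟨h1, x, h2, h3⟩
    · have := H (mem_filter.2 ⟨hv, w, hw, h⟩)
      simp at this
  have h2 : active G (T.filter fun u => ¬ G.Adj v u) + 2 ≤ active G T := by
    have hvw : v ≠ w := h.ne
    have : #(({x ∈ T.filter fun u => ¬ G.Adj v u |
        ∃ y ∈ T.filter fun u => ¬ G.Adj v u, G.Adj x y} : Finset (Fin n)) ∪ {v, w}) ≤
        active G T := by
      refine card_le_card fun u hu => ?_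
      simp only [mem_filter, mem_union, mem_insert, mem_singleton] at hu ⊢
      rcases hu with ⟨⟨h1, -⟩, x, ⟨h2, -⟩, h3⟩ | rfl | rfl
      · exact ⟨h1, x, h2, h3⟩
      · exact ⟨hv, w, hw, h⟩
      · exact ⟨hw, v, hv, h.symm⟩
    rw [card_union_of_disjoint, card_pair hvw] at this
    · exact this
    · rw [disjoint_right]
      simp only [mem_insert, mem_singleton, mem_filter]
      rintro u (rfl | rfl)
      · rintro ⟨-, x, ⟨-, hx⟩, hx'⟩; exact hx hx'
      · rintro ⟨⟨-, hx⟩, -⟩; exact hx h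
  have e2 := Nat.fib_mono
    (show active G (T.filter fun u => ¬ G.Adj v u) + 3 ≤ active G T + 1 by omega)
  have e3 := Nat.fib_mono (show active G (T.erase v) + 3 ≤ active G T + 2 by omega)
  have e4 : Nat.fib (active G T + 3) = Nat.fib (active G T + 1) + Nat.fib (active G T + 2) :=
    Nat.fib_add_two
  rw [← pot_add_one] at e2 e3 e4
  omega

/-- The base 17/10 lies above the golden ratio, as `2.89 ≥ 2.7`, and below 2. -/
theorem fib_le_pow (m : ℕ) : (Nat.fib m : ℝ) ≤ (17 / 10 : ℝ) ^ m := by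
  induction m using Nat.twoStepInduction with
  | zero => simp
  | one => norm_num
  | more m h1 h2 =>
    rw [Nat.fib_add_two]
    push_cast
    have : (0 : ℝ) < (17 / 10) ^ m := by positivity
    rw [pow_succ] at h2 ⊢
    rw [pow_succ]
    linarith

end GraphColoring

/-! ### The exponential saving in the number of sets -/

namespace GraphColoring

open Finset

open scoped Classical

variable {n : ℕ} (G : SimpleGraph (Fin n))

/-! ### The size of the family of subsets of complements of good sets -/

/-- The subsets of complements of good sets. -/
noncomputable def fam : Finset (Finset (Fin n)) := {S | ∃ T, Good G T ∧ Disjoint S T}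

/-- A family of small sets that does not cover any point too often has a large subfamily of
pairwise disjoint sets. -/
theorem exists_pairwiseDisjoint {V : Type*} [Fintype V] [DecidableEq V] (B : Finset V) (P : V → Finset V) (p q : ℕ)
    (hne : ∀ b ∈ B, (P b).Nonempty) (hp : ∀ b ∈ B, #(P b) ≤ p)
    (hq : ∀ u, #{b ∈ B | u ∈ P b} ≤ q) :
    ∃ A ⊆ B, (∀ a ∈ A, ∀ b ∈ A, a ≠ b → Disjoint (P a) (P b)) ∧ #B ≤ #A * (p * q) := by
  obtain ⟨A, -, hA⟩ := (Set.toFinite {A : Finset V | A ⊆ B ∧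
    ∀ a ∈ A, ∀ b ∈ A, a ≠ b → Disjoint (P a) (P b)}).exists_le_maximal
      (show (∅ : Finset V) ∈ _ by simp)
  refine ⟨A, hA.1.1, hA.1.2, ?_⟩
  -- By maximality of `A`, each `P b` meets some `P a` with `a ∈ A`. There are at most `p` meeting
  -- points in each `P a`, and each lies in at most `q` sets.
  have hsub : B ⊆ A.biUnion fun a => (P a).biUnion fun u => {b ∈ B | u ∈ P b} := by
    intro b hb
    by_contra hcon
    simp only [mem_biUnion, mem_filter, not_exists, not_and] at hcon
    have hdis : ∀ a ∈ A, Disjoint (P a) (P b) := fun a ha =>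
      disjoint_left.2 fun u hu hu' => hcon a ha u hu hb hu'
    have hbA : b ∈ A := by
      refine hA.2 (y := insert b A) ⟨insert_subset hb hA.1.1, ?_⟩ (subset_insert _ _)
        (mem_insert_self _ _)
      intro x hx y hy hxy
      rw [mem_insert] at hx hy
      rcases hx with rfl | hx <;> rcases hy with rfl | hy
      · exact absurd rfl hxy
      · exact (hdis y hy).symm
      · exact hdis x hx
      · exact hA.1.2 x hx y hy hxy
    have := hdis b hbA
    rw [disjoint_self] at this
    exact (hne b hb).ne_empty this
  refine (card_le_card hsub).trans (card_biUnion_le_card_mul _ _ _ fun a ha => ?_)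
  exact (card_biUnion_le_card_mul _ _ q fun u _ => hq u).trans
    (Nat.mul_le_mul_right _ (hp a (hA.1.1 ha)))

/-- For a uniformly random `S` the events `P a ⊆ S` with disjoint `P a` are independent, each of
probability at least `2 ^ (-p)`. Hence the probability that none occurs is at most `(1 - 2 ^ (-p)) ^
#A`; the statement is this bound with denominators cleared. -/
theorem card_filter_not_subset_le {V : Type*} [Fintype V] [DecidableEq V] (P : V → Finset V) (p : ℕ) (A : Finset V)
    (hp : ∀ a ∈ A, #(P a) ≤ p) (hA : ∀ a ∈ A, ∀ b ∈ A, a ≠ b → Disjoint (P a) (P b)) :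
    #{S : Finset V | ∀ a ∈ A, ¬ P a ⊆ S} * (2 ^ p) ^ #A ≤
      2 ^ Fintype.card V * (2 ^ p - 1) ^ #A := by
  induction A using Finset.induction_on with
  | empty => simp
  | insert a A ha ih =>
    have ih := ih (fun b hb => hp b (mem_insert_of_mem hb)) fun b hb c hc =>
      hA b (mem_insert_of_mem hb) c (mem_insert_of_mem hc)
    set F : Finset (Finset V) := {S | ∀ b ∈ A, ¬ P b ⊆ S} with hF
    have hdis : ∀ b ∈ A, Disjoint (P b) (P a) := fun b hb =>
      hA b (mem_insert_of_mem hb) a (mem_insert_self _ _) (fun h => ha (h ▸ hb))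
    have hsplit : #{S ∈ F | P a ⊆ S} + #{S ∈ F | ¬ P a ⊆ S} = #F :=
      card_filter_add_card_filter_not _
    have hgood : (univ.filter fun S : Finset V => ∀ b ∈ insert a A, ¬ P b ⊆ S) =
        {S ∈ F | ¬ P a ⊆ S} := by
      ext S; simp [hF, and_comm]
    -- The map `S ↦ S ∪ P a` preserves the conditions for the other sets, by disjointness, and has
    -- fibres of size at most `2 ^ p`. So at least a fraction `2 ^ (-p)` of `F` contains `P a`.
    have hfib : #F ≤ 2 ^ p * #{S ∈ F | P a ⊆ S} := by
      refine card_le_mul_card_image_of_maps_to (f := fun S => S ∪ P a) ?_ _ ?_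
      · intro S hS
        simp only [hF, mem_filter, mem_univ, true_and] at hS ⊢
        refine ⟨fun b hb h => hS b hb fun x hx => ?_, subset_union_right⟩
        rcases mem_union.1 (h hx) with h' | h'
        · exact h'
        · exact absurd h' (disjoint_left.1 (hdis b hb) hx)
      · intro U _
        calc #{S ∈ F | S ∪ P a = U} ≤ #(P a).powerset := by
              refine card_le_card_of_injOn (fun S => S ∩ P a)
                (fun S _ => mem_coe.2 (mem_powerset.2 inter_subset_right)) ?_
              intro S hS S' hS' h
              simp only [coe_filter, Set.mem_ofPred_eq] at hS hS'
              ext x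
              have h1 : x ∈ S ∪ P a ↔ x ∈ S' ∪ P a := by rw [hS.2, hS'.2]
              have h2 : x ∈ S ∩ P a ↔ x ∈ S' ∩ P a := by rw [show S ∩ P a = S' ∩ P a from h]
              simp only [mem_union, mem_inter] at h1 h2
              tauto
          _ ≤ 2 ^ p := by
              rw [card_powerset]
              exact Nat.pow_le_pow_right (by norm_num) (hp a (mem_insert_self _ _))
    rw [hgood, card_insert_of_notMem ha, pow_succ, pow_succ]
    have hpos : 1 ≤ 2 ^ p := Nat.one_le_two_pow
    have hstep : #{S ∈ F | ¬ P a ⊆ S} * 2 ^ p ≤ #F * (2 ^ p - 1) := by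
      obtain ⟨m, hm⟩ := Nat.exists_eq_add_of_le' hpos
      rw [hm] at hfib ⊢
      rw [Nat.add_sub_cancel]
      nlinarith
    calc _ = (#{S ∈ F | ¬ P a ⊆ S} * 2 ^ p) * (2 ^ p) ^ #A := by ring
      _ ≤ (#F * (2 ^ p - 1)) * (2 ^ p) ^ #A := Nat.mul_le_mul_right _ hstep
      _ = (#F * (2 ^ p) ^ #A) * (2 ^ p - 1) := by ring
      _ ≤ (2 ^ Fintype.card V * (2 ^ p - 1) ^ #A) * (2 ^ p - 1) := Nat.mul_le_mul_right _ ih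
      _ = _ := by ring

/-- Vertices of large degree are rare compared to the degree, for some degree in a bounded range. -/
theorem exists_threshold (γ : ℝ) (hγ : 0 < γ) (D d : ℕ) :
    ∃ J, ∀ (n : ℕ) (G : SimpleGraph (Fin n)), degSum G ≤ d * n →
      ∃ t, D ≤ t ∧ t ≤ J ∧ (#{v | t < dg G v} : ℝ) * (t + 1) ≤ γ * n := by
  -- The harmonic series diverges, so its part from `D` up to `N` can be made larger than `d / γ`.
  obtain ⟨N, hN⟩ := (Real.tendsto_sum_range_one_div_nat_succ_atTop.eventually_gt_atTop
    (d / γ + ∑ i ∈ range D, (1 / (i + 1) : ℝ))).exists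
  refine ⟨N + D, fun n G hG => ?_⟩
  by_contra! hcon
  rcases Nat.eq_zero_or_pos n with rfl | hn
  · have := hcon D le_rfl (Nat.le_add_left _ _)
    simp at this
  have hDN : D ≤ N := by
    by_contra! h
    have h1 : ∑ i ∈ range N, (1 / (i + 1) : ℝ) ≤ ∑ i ∈ range D, (1 / (i + 1) : ℝ) :=
      sum_le_sum_of_subset_of_nonneg (range_mono h.le) fun i _ _ => by positivity
    have h2 : (0 : ℝ) ≤ d / γ := by positivity
    linarith
  -- Each vertex `v` is counted for at most `dg G v` values of `t`. If every `t` failed, the same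
  -- sum would be at least `γ n` times the harmonic sum, hence exceed `d n`.
  have h1 : ∑ t ∈ Ico D N, #{v | t < dg G v} ≤ d * n := by
    refine le_trans ?_ hG
    calc ∑ t ∈ Ico D N, #{v | t < dg G v} = ∑ v, #{t ∈ Ico D N | t < dg G v} := by
          simp only [card_filter]; rw [sum_comm]
      _ ≤ ∑ v, dg G v := sum_le_sum fun v _ => by
          refine (card_le_card (t := range (dg G v)) fun t ht => ?_).trans (by simp)
          rw [mem_range]; exact (mem_filter.1 ht).2
  have h2 : ∑ t ∈ Ico D N, (γ * n) * (1 / (t + 1) : ℝ) ≤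
      ∑ t ∈ Ico D N, (#{v | t < dg G v} : ℝ) := by
    refine sum_le_sum fun t ht => ?_
    rw [mem_Ico] at ht
    rw [mul_one_div, div_le_iff₀ (by positivity)]
    exact (hcon t ht.1 (by omega)).le
  rw [← mul_sum, sum_Ico_eq_sub _ hDN] at h2
  have h3 : (∑ t ∈ Ico D N, (#{v | t < dg G v} : ℝ)) ≤ d * n := by exact_mod_cast h1
  have hn' : (0 : ℝ) < n := by exact_mod_cast hn
  have h4 : (γ * n) * (d / γ) < (γ * n) *
      (∑ i ∈ range N, (1 / (i + 1) : ℝ) - ∑ i ∈ range D, (1 / (i + 1) : ℝ)) :=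
    mul_lt_mul_of_pos_left (by linarith) (by positivity)
  have h5 : (γ * n) * (d / γ) = d * n := by field_simp
  linarith

variable {G}

/-- A good set has many vertices of small degree. -/
theorem Good.card_low {T : Finset (Fin n)} (hT : Good G T) {d : ℕ} (hd : degSum G ≤ d * n) :
    n ≤ 2 * (2 * d + 1) * #{v ∈ T | dg G v ≤ 2 * d * (2 * d + 1)} := by
  rcases Nat.eq_zero_or_pos n with h0 | hn
  · omega
  have h1 : n ≤ #T * (2 * d + 1) := by
    refine Nat.le_of_mul_le_mul_right (hT.2.2.trans ?_) hn
    calc #T * (2 * degSum G + n) ≤ #T * (2 * (d * n) + n) :=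
          Nat.mul_le_mul_left _ (by omega)
      _ = _ := by ring
  set K := 2 * d + 1
  set x := #{v ∈ T | ¬ dg G v ≤ 2 * d * K} with hx
  have h2 : x * (2 * d * K + 1) ≤ d * n := by
    refine le_trans ?_ hd
    rw [hx, ← smul_eq_mul]
    refine (card_nsmul_le_sum _ (fun v => dg G v) _ fun v hv => ?_).trans
      (sum_le_sum_of_subset (subset_univ _))
    have := (mem_filter.1 hv).2
    omega
  have h3 : #{v ∈ T | dg G v ≤ 2 * d * K} + x = #T := card_filter_add_card_filter_not _
  -- Markov's inequality: vertices of degree above `2 d K` number at most `n / (2K)`, which is half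
  -- of the lower bound `n / K` for the size of `T`.
  have h4 : 2 * K * x ≤ n := by
    rcases Nat.eq_zero_or_pos d with rfl | hd
    · have : x = 0 := by simpa using h2
      rw [this]; omega
    · refine le_of_mul_le_mul_left (a := d) ?_ hd
      nlinarith
  rw [← h3] at h1
  nlinarith

/-- The subsets of complements of good sets that meet the vertices of large degree in `X`. -/
theorem card_fam_fiber_le {d t : ℕ} (hd : degSum G ≤ d * n) (ht : 2 * d * (2 * d + 1) ≤ t)
    (X : Finset (Fin n)) :
    ∃ m : ℕ, n ≤ 2 * (2 * d + 1) * (m * ((2 * d * (2 * d + 1) + 1) * (t + 1))) ∧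
      #{S : Finset (Fin n) | ∃ T, Good G T ∧ Disjoint S T ∧ {v ∈ T | t < dg G v} = X} *
        (2 ^ (2 * d * (2 * d + 1) + 1)) ^ m ≤
      2 ^ n * (2 ^ (2 * d * (2 * d + 1) + 1) - 1) ^ m := by
  set D := 2 * d * (2 * d + 1)
  rcases Finset.eq_empty_or_nonempty (univ.filter fun S : Finset (Fin n) =>
    ∃ T, Good G T ∧ Disjoint S T ∧ {v ∈ T | t < dg G v} = X) with h0 | ⟨S₀, hS₀⟩
  -- An empty fibre satisfies the second bound for every `m`, so `m = n` only has to meet the first.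
  · refine ⟨n, ?_, by rw [h0]; simp⟩
    have : 1 ≤ 2 * (2 * d + 1) * ((D + 1) * (t + 1)) := Nat.succ_le_of_lt (by positivity)
    nlinarith
  simp only [mem_filter, mem_univ, true_and] at hS₀
  obtain ⟨T₀, hT₀, -, hX₀⟩ := hS₀
  -- `B` contains all vertices of `T₀` of degree at most `D`, since `X ⊆ T₀` and `T₀` is
  -- independent; this makes `B` large. `P b` is the closed neighbourhood of `b` without the
  -- vertices of degree above `t`, so a vertex lies in at most `t + 1` of these sets.
  set B : Finset (Fin n) := {b | dg G b ≤ D ∧ ∀ x ∈ X, ¬ G.Adj b x} with hB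
  set P : Fin n → Finset (Fin n) := fun b => {u | (u = b ∨ G.Adj b u) ∧ dg G u ≤ t} with hP
  have hcl : ∀ b, #{u | u = b ∨ G.Adj b u} ≤ dg G b + 1 := by
    intro b
    rw [filter_or]
    refine (card_union_le _ _).trans ?_
    rw [add_comm]
    refine Nat.add_le_add le_rfl ?_
    simp [filter_eq']
  obtain ⟨A, hAB, hA, hcard⟩ := exists_pairwiseDisjoint B P (D + 1) (t + 1)
    (fun b hb => ⟨b, by
      simp only [hB, hP, mem_filter, mem_univ, true_and, true_or] at hb ⊢
      exact hb.1.trans ht⟩)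
    (fun b hb => by
      refine (card_le_card fun u hu => ?_).trans ((hcl b).trans (Nat.succ_le_succ
        (mem_filter.1 hb).2.1))
      simp only [hP, mem_filter, mem_univ, true_and] at hu ⊢
      exact hu.1)
    (fun u => by
      by_cases hu : dg G u ≤ t
      · refine (card_le_card fun b hb => ?_).trans ((hcl u).trans (Nat.succ_le_succ hu))
        simp only [hP, mem_filter, mem_univ, true_and] at hb ⊢
        rcases hb.2.1 with h | h
        · exact .inl h.symm
        · exact .inr h.symm
      · rw [filter_false_of_mem]
        · simp
        · intro b _ hb
          exact hu (mem_filter.1 hb).2.2)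
  refine ⟨#A, ?_, ?_⟩
  · refine (hT₀.card_low hd).trans (Nat.mul_le_mul_left _ (le_trans (card_le_card ?_) hcard))
    intro v hv
    simp only [hB, mem_filter, mem_univ, true_and] at hv ⊢
    refine ⟨hv.2, fun x hx => ?_⟩
    rw [← hX₀, mem_filter] at hx
    exact hT₀.1 v hv.1 x hx.1
  · have key := card_filter_not_subset_le P (D + 1) A
      (fun b hb => by
        refine (card_le_card fun u hu => ?_).trans ((hcl b).trans (Nat.succ_le_succ
          (mem_filter.1 (hAB hb)).2.1))
        simp only [hP, mem_filter, mem_univ, true_and] at hu ⊢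
        exact hu.1) hA
    rw [Fintype.card_fin] at key
    refine le_trans (Nat.mul_le_mul_right _ (card_le_card fun S hS => ?_)) key
    simp only [mem_filter, mem_univ, true_and] at hS ⊢
    obtain ⟨T, hT, hST, hX⟩ := hS
    -- `P a` meets `T`, which is disjoint from `S`. Either `a ∈ T`, or maximality gives a neighbour
    -- of `a` in `T`; its degree is at most `t`, as otherwise it would lie in `X`, to which `a` is
    -- not adjacent.
    intro a ha hsub
    have haB := hAB ha
    simp only [hB, mem_filter, mem_univ, true_and] at haB
    by_cases haT : a ∈ T
    · refine disjoint_left.1 hST (hsub ?_) haT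
      simp only [hP, mem_filter, mem_univ, true_and, true_or]
      exact haB.1.trans ht
    · have hni := hT.2.1 a haT
      have : ∃ y ∈ T, G.Adj a y := by
        by_contra! hno
        refine hni fun u hu v hv => ?_
        rw [mem_insert] at hu hv
        rcases hu with rfl | hu <;> rcases hv with rfl | hv
        · exact G.loopless.irrefl _
        · exact hno v hv
        · exact fun h => hno u hu h.symm
        · exact hT.1 u hu v hv
      obtain ⟨y, hy, hay⟩ := this
      refine disjoint_left.1 hST (hsub ?_) hy
      simp only [hP, mem_filter, mem_univ, true_and]
      refine ⟨.inr hay, ?_⟩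
      by_contra! h
      refine haB.2 y ?_ hay
      rw [← hX, mem_filter]
      exact ⟨hy, h⟩

/-- Sum the fibre bound over the possible sets `X` of high vertices. Each fibre saves `exp (-2 lam n
/ (t+1))`, the choice of `X` costs at most `exp (lam n / (t+1))`, and `t ≤ J` makes the net saving
uniform. -/
theorem exists_card_fam_le (d : ℕ) : ∃ ρ : ℝ, 0 < ρ ∧ ρ < 1 ∧
    ∀ (n : ℕ) (G : SimpleGraph (Fin n)), degSum G ≤ d * n → (#(fam G) : ℝ) ≤ (2 * ρ) ^ n := by
  set K : ℕ := 2 * d + 1 with hK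
  set D : ℕ := 2 * d * (2 * d + 1) with hD
  set q : ℝ := ((2 : ℝ) ^ (D + 1) - 1) / 2 ^ (D + 1) with hq
  have h2 : (2 : ℝ) ≤ 2 ^ (D + 1) := by
    calc (2 : ℝ) = 2 ^ 1 := by norm_num
      _ ≤ _ := pow_le_pow_right₀ (by norm_num) (by omega)
  have hq0 : 0 < q := div_pos (by linarith) (by positivity)
  have hq1 : q < 1 := by rw [hq, div_lt_one (by positivity)]; linarith
  set L : ℝ := -Real.log q with hL
  have hLpos : 0 < L := neg_pos.2 (Real.log_neg hq0 hq1)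
  -- With `m ≥ n / (2K(D+1)(t+1))` the saving `q ^ m` has exponent at least `2 lam n / (t+1)`. The 4
  -- in the denominator reserves half of this for the choice of `X`, which fixes `γ = lam / log 2`
  -- below.
  set lam : ℝ := L / (4 * K * (D + 1)) with hlam
  have hKpos : (0 : ℝ) < K := by rw [hK]; positivity
  have hlampos : 0 < lam := by positivity
  have hlog2 : 0 < Real.log 2 := Real.log_pos (by norm_num)
  obtain ⟨J, hJ⟩ := exists_threshold (lam / Real.log 2) (by positivity) D d
  refine ⟨Real.exp (-(lam / (J + 1))), Real.exp_pos _, ?_, fun n G hG => ?_⟩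
  · rw [Real.exp_lt_one_iff]
    have : 0 < lam / (J + 1) := by positivity
    linarith
  obtain ⟨t, hDt, htJ, ht⟩ := hJ n G hG
  set H : Finset (Fin n) := {v | t < dg G v} with hH
  set fib : Finset (Fin n) → Finset (Finset (Fin n)) := fun X =>
    {S | ∃ T, Good G T ∧ Disjoint S T ∧ {v ∈ T | t < dg G v} = X} with hfib
  have hsub : fam G ⊆ H.powerset.biUnion fib := by
    intro S hS
    simp only [fam, mem_filter, mem_univ, true_and] at hS
    obtain ⟨T, hT, hST⟩ := hS
    rw [mem_biUnion]
    refine ⟨{v ∈ T | t < dg G v}, ?_, ?_⟩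
    · rw [mem_powerset]
      intro v hv
      simp only [hH, mem_filter, mem_univ, true_and] at hv ⊢
      exact hv.2
    · simp only [hfib, mem_filter, mem_univ, true_and]
      exact ⟨T, hT, hST, rfl⟩
  have hX : ∀ X, (#(fib X) : ℝ) ≤ 2 ^ n * Real.exp (-(2 * lam * n / (t + 1))) := by
    intro X
    obtain ⟨m, hm, hc⟩ := card_fam_fiber_le hG hDt X
    have hc' : (#(fib X) : ℝ) * (2 ^ (D + 1)) ^ m ≤ 2 ^ n * (2 ^ (D + 1) - 1) ^ m := by
      have h1 : 1 ≤ 2 ^ (D + 1) := Nat.one_le_two_pow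
      have : ((#(fib X) * (2 ^ (D + 1)) ^ m : ℕ) : ℝ) ≤
        ((2 ^ n * (2 ^ (D + 1) - 1) ^ m : ℕ) : ℝ) := by exact_mod_cast hc
      push_cast [Nat.cast_sub h1] at this
      exact this
    have hqm : (#(fib X) : ℝ) ≤ 2 ^ n * q ^ m := by
      rw [hq, div_pow, mul_div_assoc', le_div_iff₀ (by positivity)]
      exact hc'
    refine hqm.trans (mul_le_mul_of_nonneg_left ?_ (by positivity))
    have : q ^ m = Real.exp (-(L * m)) := by
      rw [hL, neg_mul, neg_neg, mul_comm, Real.exp_nat_mul, Real.exp_log hq0]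
    rw [this, Real.exp_le_exp, neg_le_neg_iff, div_le_iff₀ (by positivity)]
    have hm' : (n : ℝ) ≤ 2 * K * (m * ((D + 1) * (t + 1))) := by
      rw [hK]
      exact_mod_cast hm
    have hl : lam * (4 * K * (D + 1)) = L := by rw [hlam]; field_simp
    calc 2 * lam * n ≤ 2 * lam * (2 * K * (m * ((D + 1) * (t + 1)))) := by gcongr
      _ = (lam * (4 * K * (D + 1))) * m * (t + 1) := by ring
      _ = _ := by rw [hl]
  have hHexp : (2 : ℝ) ^ #H ≤ Real.exp (lam * n / (t + 1)) := by
    have : (2 : ℝ) ^ #H = Real.exp (#H * Real.log 2) := by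
      rw [Real.exp_nat_mul, Real.exp_log (by norm_num)]
    rw [this, Real.exp_le_exp, le_div_iff₀ (by positivity)]
    calc (#H : ℝ) * Real.log 2 * (t + 1) = (#H * (t + 1)) * Real.log 2 := by ring
      _ ≤ (lam / Real.log 2 * n) * Real.log 2 := by gcongr
      _ = lam * n := by field_simp
  calc (#(fam G) : ℝ) ≤ ∑ X ∈ H.powerset, (#(fib X) : ℝ) := by
        exact_mod_cast (card_le_card hsub).trans card_biUnion_le
    _ ≤ ∑ X ∈ H.powerset, 2 ^ n * Real.exp (-(2 * lam * n / (t + 1))) :=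
        sum_le_sum fun X _ => hX X
    _ = 2 ^ #H * (2 ^ n * Real.exp (-(2 * lam * n / (t + 1)))) := by
        rw [sum_const, card_powerset, nsmul_eq_mul]; push_cast; ring
    _ ≤ Real.exp (lam * n / (t + 1)) * (2 ^ n * Real.exp (-(2 * lam * n / (t + 1)))) := by
        gcongr
    _ = 2 ^ n * Real.exp (-(lam * n / (t + 1))) := by
        rw [mul_left_comm, ← Real.exp_add]; congr 2; ring
    _ ≤ 2 ^ n * Real.exp (-(lam * n / (J + 1))) := by
        gcongr
    _ = _ := by
        rw [mul_pow, ← Real.exp_nat_mul]; congr 2; ring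

end GraphColoring

/-! ### The program: memory layout and elementary subroutines -/

namespace GraphColoring

open Finset RAM

open scoped Classical

/-! ### Expressions -/

abbrev R (r : ℕ) : Expr := .reg r

abbrev K (k : ℕ) : Expr := .const k

instance : Add Expr := ⟨.op .add⟩
instance : Sub Expr := ⟨.op .sub⟩
instance : Mul Expr := ⟨.op .mul⟩
instance : Div Expr := ⟨.op .div⟩

/-- The address of cell `x` of array `c`, where register `0` holds the number of vertices. -/
def cell (c : ℕ) (x : Expr) : Expr := R 0 * R 0 + K 6 * x + K c

def get (c : ℕ) (x : Expr) : Expr := .mem (cell c x)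

def put (c : ℕ) (x e : Expr) : Prog := .store (cell c x) e

/-- The digit of `a` at the position `v`, where array `5` holds the powers of two. -/
def bit (a v : Expr) : Expr := a / get 5 v - K 2 * (a / get 5 v / K 2)

section Eval

variable (s : State)

@[simp] theorem eval_R (r : ℕ) : (R r).eval s = s.reg r := rfl
@[simp] theorem eval_K (k : ℕ) : (K k).eval s = k := rfl
@[simp] theorem eval_add (a b : Expr) : (a + b).eval s = a.eval s + b.eval s := rfl
@[simp] theorem eval_sub (a b : Expr) : (a - b).eval s = a.eval s - b.eval s := rfl
@[simp] theorem eval_mul (a b : Expr) : (a * b).eval s = a.eval s * b.eval s := rfl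
@[simp] theorem eval_div (a b : Expr) : (a / b).eval s = a.eval s / b.eval s := rfl
@[simp] theorem eval_mem (a : Expr) : (Expr.mem a).eval s = s.mem (a.eval s) := rfl

end Eval

variable {n : ℕ} {G : SimpleGraph (Fin n)}

/-- The memory holds the adjacency matrix, followed by six interleaved arrays `F 0, …, F 5`. -/
structure View (G : SimpleGraph (Fin n)) (F : ℕ → ℕ → ℕ) (mem : ℕ → ℕ) : Prop where
  adj : ∀ i j : Fin n, mem (i * n + j) = if G.Adj i j then 1 else 0
  arr : ∀ c < 6, ∀ x, mem (n * n + 6 * x + c) = F c x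

/-- Change of one entry of an array. -/
def upd (F : ℕ → ℕ → ℕ) (c x v : ℕ) : ℕ → ℕ → ℕ :=
  fun c' x' => if c' = c ∧ x' = x then v else F c' x'

theorem upd_of_ne {F : ℕ → ℕ → ℕ} {c x v c' : ℕ} (h : c' ≠ c) : upd F c x v c' = F c' := by
  funext x'; simp [upd, h]

theorem upd_apply (F : ℕ → ℕ → ℕ) (c x v x' : ℕ) :
    upd F c x v c x' = if x' = x then v else F c x' := by
  simp [upd]

theorem fin_mul_add_lt (i j : Fin n) : (i : ℕ) * n + j < n * n := by
  have h1 := i.2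
  have h2 := j.2
  calc (i : ℕ) * n + j < i * n + n := by omega
    _ = (i + 1) * n := by ring
    _ ≤ n * n := Nat.mul_le_mul_right _ h1

/-- Distinct arrays occupy distinct residues modulo 6 after the offset `n * n`, so a write touches
neither another array nor the adjacency matrix. -/
theorem View.setM {F : ℕ → ℕ → ℕ} {s : State} (h : View G F s.mem) {c : ℕ} (hc : c < 6) (x v : ℕ) :
    View G (upd F c x v) (s.setM (n * n + 6 * x + c) v).mem := by
  refine ⟨fun i j => ?_, fun c' hc' x' => ?_⟩
  · rw [State.setM_mem, if_neg, h.adj]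
    have := fin_mul_add_lt i j
    omega
  · rw [State.setM_mem, upd]
    split_ifs with h1 h2 h2
    · rfl
    · omega
    · omega
    · exact h.arr c' hc' x'

theorem View.get_eval {F : ℕ → ℕ → ℕ} {s : State} (h : View G F s.mem) (h0 : s.reg 0 = n) {c : ℕ}
    (hc : c < 6) (x : Expr) : (get c x).eval s = F c (x.eval s) := by
  rw [get, eval_mem, cell]
  simp only [eval_add, eval_mul, eval_R, eval_K, h0]
  exact h.arr c hc _

/-- The parts of the state that stay the same during the main part of the algorithm. -/
structure Ctx (G : SimpleGraph (Fin n)) (F : ℕ → ℕ → ℕ) (s : State) : Prop where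
  reg0 : s.reg 0 = n
  reg1 : s.reg 1 = degSum G
  view : View G F s.mem
  pow : ∀ v ≤ n, F 5 v = 2 ^ v

theorem Ctx.setR {F : ℕ → ℕ → ℕ} {s : State} (h : Ctx G F s) {r v : ℕ} (hr : 2 ≤ r) :
    Ctx G F (s.setR r v) where
  reg0 := by rw [State.setR_reg, if_neg (by omega)]; exact h.reg0
  reg1 := by rw [State.setR_reg, if_neg (by omega)]; exact h.reg1
  view := h.view
  pow := h.pow

theorem Ctx.of_same {F : ℕ → ℕ → ℕ} {s s' : State} (h : Ctx G F s) (hm : s'.mem = s.mem)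
    (h0 : s'.reg 0 = s.reg 0) (h1 : s'.reg 1 = s.reg 1) : Ctx G F s' :=
  ⟨h0.trans h.reg0, h1.trans h.reg1, hm ▸ h.view, h.pow⟩

theorem Ctx.get_eval {F : ℕ → ℕ → ℕ} {s : State} (h : Ctx G F s) {c : ℕ} (hc : c < 6) (x : Expr) :
    (get c x).eval s = F c (x.eval s) :=
  h.view.get_eval h.reg0 hc x

theorem Ctx.bit_eval {F : ℕ → ℕ → ℕ} {s : State} (h : Ctx G F s) {a x : Expr}
    {A : Finset (Fin n)} {v : Fin n} (ha : a.eval s = msk A) (hx : x.eval s = v) :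
    (bit a x).eval s = if v ∈ A then 1 else 0 := by
  rw [bit]
  simp only [eval_sub, eval_mul, eval_div, eval_K, h.get_eval (show 5 < 6 by norm_num), ha, hx,
    h.pow v v.2.le]
  rw [← msk_div_mod]
  omega

/-! ### Rules for single steps -/

variable {W T : ℕ} {s : State} {Q : State → Prop}

theorem one_le_of_sq_le (hW : (n + 3) * (n + 3) ≤ W) : 1 ≤ W := by nlinarith

theorem lt_of_le_sq (hW : (n + 3) * (n + 3) ≤ W) {x : ℕ} (h : x ≤ (n + 3) * (n + 3)) :
    x < 2 ^ W :=
  (h.trans hW).trans_lt Nat.lt_two_pow_self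

/-- A word length of `(n+3)^2` accommodates the largest numbers that occur, the powers `(2 ^ n) ^ k`
with `k ≤ n`, with room to spare. -/
theorem lt_of_le_pow (hW : (n + 3) * (n + 3) ≤ W) {x : ℕ} (h : x ≤ 2 ^ ((n + 2) * (n + 2))) :
    x < 2 ^ W :=
  h.trans_lt (Nat.pow_lt_pow_right (by norm_num) (by nlinarith))

theorem msk_lt_pow (hW : (n + 3) * (n + 3) ≤ W) (A : Finset (Fin n)) : msk A < 2 ^ W :=
  lt_of_le_pow hW ((msk_lt A).le.trans (Nat.pow_le_pow_right (by norm_num) (by nlinarith)))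

theorem _root_.RAM.Reach.mono_post {P : Prog} {Q' : State → Prop} (h : Reach W T P s Q)
    (hQ : ∀ s', Q s' → Q' s') : Reach W T P s Q' := h.mono le_rfl hQ

/-- Run `p`, and `q` with the remaining number of steps. -/
theorem _root_.RAM.Reach.andThen {T₁ : ℕ} {p q : Prog} {Q' : State → Prop} (hp : Reach W T₁ p s Q) (hT : T₁ ≤ T)
    (hq : ∀ s', Q s' → Reach W (T - T₁) q s' Q') : Reach W T (.seq p q) s Q' :=
  hp.seq hq (by omega)

theorem Reach.set_last (hW : (n + 3) * (n + 3) ≤ W) {r v : ℕ} {e : Expr} (he : e.eval s = v)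
    (hv : v < 2 ^ W) (hT : 1 ≤ T) (h : Q (s.setR r v))
    (hc : e.charge + e.wt + r + 2 ≤ 10000 := by decide) : Reach W T (.set r e) s Q := by
  subst he
  exact (Reach.set (one_le_of_sq_le hW) hc hv h).mono hT fun _ h => h

theorem Reach.set_then (hW : (n + 3) * (n + 3) ≤ W) {r v : ℕ} {e : Expr} {q : Prog}
    (he : e.eval s = v) (hv : v < 2 ^ W) (hT : 1 ≤ T) (h : Reach W (T - 1) q (s.setR r v) Q)
    (hc : e.charge + e.wt + r + 2 ≤ 10000 := by decide) :
    Reach W T (.seq (.set r e) q) s Q :=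
  (Reach.set_last (Q := fun s' => s' = s.setR r v) hW he hv le_rfl rfl hc).andThen hT
    fun _ hs => hs ▸ h

theorem Reach.put_last (hW : (n + 3) * (n + 3) ≤ W) {F : ℕ → ℕ → ℕ} (hs : Ctx G F s) {c a v : ℕ}
    {x e : Expr} (hc : c < 5) (hx : x.eval s = a) (he : e.eval s = v) (hv : v < 2 ^ W)
    (hT : 1 ≤ T) (h : ∀ s', s'.reg = s.reg → Ctx G (upd F c a v) s' → Q s')
    (hch : (cell c x).charge + e.charge + (cell c x).wt + e.wt + 1 ≤ 10000 := by decide) :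
    Reach W T (put c x e) s Q := by
  have hcell : (cell c x).eval s = n * n + 6 * a + c := by
    simp [cell, hs.reg0, hx]
  subst he
  refine (Reach.store (one_le_of_sq_le hW) hch hv ?_).mono hT fun _ h => h
  refine h _ rfl ⟨hs.reg0, hs.reg1, hcell ▸ hs.view.setM (by omega) a _, ?_⟩
  rw [upd_of_ne (by omega)]
  exact hs.pow

theorem Reach.put_then (hW : (n + 3) * (n + 3) ≤ W) {F : ℕ → ℕ → ℕ} (hs : Ctx G F s) {c a v : ℕ}
    {x e : Expr} {q : Prog} (hc : c < 5) (hx : x.eval s = a) (he : e.eval s = v) (hv : v < 2 ^ W)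
    (hT : 1 ≤ T)
    (h : ∀ s', s'.reg = s.reg → Ctx G (upd F c a v) s' → Reach W (T - 1) q s' Q)
    (hch : (cell c x).charge + e.charge + (cell c x).wt + e.wt + 1 ≤ 10000 := by decide) :
    Reach W T (.seq (put c x e) q) s Q :=
  (Reach.put_last (Q := fun s' => s'.reg = s.reg ∧ Ctx G (upd F c a v) s') hW hs hc hx he hv le_rfl
    (fun _ h1 h2 => ⟨h1, h2⟩) hch).andThen hT fun s' hs' => h s' hs'.1 hs'.2

theorem Reach.ite_of (hW : (n + 3) * (n + 3) ≤ W) {e : Expr} {p q : Prog} (hT : 1 ≤ T)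
    (hp : e.eval s ≠ 0 → Reach W (T - 1) p s Q) (hq : e.eval s = 0 → Reach W (T - 1) q s Q)
    (hc : e.charge + 1 ≤ 10000 := by decide) : Reach W T (.ite e p q) s Q :=
  (Reach.ite (one_le_of_sq_le hW) hc hp hq).mono (by omega) fun _ h => h

theorem Reach.skip_of (hW : (n + 3) * (n + 3) ≤ W) (hT : 1 ≤ T) (h : Q s) : Reach W T .skip s Q :=
  (Reach.skip (one_le_of_sq_le hW) h).mono hT fun _ h => h

/-! ### Search for two adjacent vertices in a set -/

/-- If the set in register `3` is independent, register `4` becomes `0`, otherwise it becomes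
`v + 1` for some vertex `v` of the set that has a neighbour in the set. -/
def conflictP : Prog :=
  .seq (.set 4 (K 0)) (forP 2 (R 0 * R 0)
    (.ite (.mem (R 2) * bit (R 3) (R 2 / R 0) * bit (R 3) (R 2 - R 0 * (R 2 / R 0)))
      (.set 4 (R 2 / R 0 + K 1)) .skip))

/-- A single counter runs over the cells of the adjacency matrix; quotient and remainder by `n`
recover the two vertices, and a product of three bits is the test. The exact final state is recorded
so that callers know that only registers 2 and 4 change. -/
theorem conflictP_spec (hW : (n + 3) * (n + 3) ≤ W) {F : ℕ → ℕ → ℕ} (hs : Ctx G F s)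
    {A : Finset (Fin n)} (hA : s.reg 3 = msk A) (hT : 4 * (n * n) + 3 ≤ T) :
    Reach W T conflictP s fun s' => ∃ c, s' = (s.setR 4 c).setR 2 (n * n) ∧
      ((c = 0 ∧ Indep G A) ∨ ∃ v ∈ A, ∃ w ∈ A, G.Adj v w ∧ c = v + 1) := by
  refine Reach.set_then hW (eval_K _ _) (by simp) (by omega) ?_
  refine ((Reach.forP (T := 2) (one_le_of_sq_le hW) (by decide) (n * n)
    (lt_of_le_sq hW (by nlinarith)) (fun i s' => ∃ c, s' = (s.setR 4 c).setR 2 i ∧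
      ((c = 0 ∧ ∀ v ∈ A, ∀ w ∈ A, (v : ℕ) * n + w < i → ¬ G.Adj v w) ∨
        ∃ v ∈ A, ∃ w ∈ A, G.Adj v w ∧ c = v + 1))
    ?_ ?_ ⟨0, rfl, .inl ⟨rfl, by simp⟩⟩)).mono (by omega) ?_
  · rintro i - _ ⟨c, rfl, -⟩
    simp [hs.reg0]
  · rintro i hi _ ⟨c, rfl, hc⟩
    have hn : 0 < n := Nat.pos_of_ne_zero (by rintro rfl; simp at hi)
    obtain ⟨v, hv⟩ : ∃ v : Fin n, (v : ℕ) = i / n := ⟨⟨i / n, Nat.div_lt_of_lt_mul hi⟩, rfl⟩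
    obtain ⟨w, hw⟩ : ∃ w : Fin n, (w : ℕ) = i % n := ⟨⟨i % n, Nat.mod_lt _ hn⟩, rfl⟩
    have hvw : (v : ℕ) * n + w = i := by rw [hv, hw, mul_comm]; exact Nat.div_add_mod i n
    have hctx : Ctx G F ((s.setR 4 c).setR 2 i) := (hs.setR (by norm_num)).setR (by norm_num)
    have e1 : (bit (R 3) (R 2 / R 0)).eval ((s.setR 4 c).setR 2 i) = if v ∈ A then 1 else 0 :=
      hctx.bit_eval (by simp [hA]) (by simp [hs.reg0, hv])
    have e2 : (bit (R 3) (R 2 - R 0 * (R 2 / R 0))).eval ((s.setR 4 c).setR 2 i) =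
        if w ∈ A then 1 else 0 :=
      hctx.bit_eval (by simp [hA]) (by
        have := Nat.div_add_mod i n
        simp [hs.reg0, hw]; omega)
    have e3 : s.mem i = if G.Adj v w then 1 else 0 := by rw [← hvw]; exact hs.view.adj v w
    refine Reach.ite_of hW (by norm_num) ?_ ?_
    · intro he
      simp only [eval_mul, e1, e2, eval_mem, eval_R, State.setR_reg, if_true, State.setR_mem,
        e3] at he
      have hv' : v ∈ A := by by_contra h; simp [h] at he
      have hw' : w ∈ A := by by_contra h; simp [h] at he
      have ha : G.Adj v w := by by_contra h; simp [h] at he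
      refine Reach.set_last hW (v := v + 1) (by simp [hs.reg0, hv])
        (lt_of_le_sq hW (by nlinarith [v.2])) le_rfl ⟨by simp, v + 1, by simp,
          .inr ⟨v, hv', w, hw', ha, rfl⟩⟩
    · intro he
      simp only [eval_mul, e1, e2, eval_mem, eval_R, State.setR_reg, if_true, State.setR_mem,
        e3] at he
      refine Reach.skip_of hW le_rfl ⟨by simp, c, by simp, ?_⟩
      refine hc.imp_left fun ⟨hc0, h⟩ => ⟨hc0, fun v' hv' w' hw' hlt hadj => ?_⟩
      rcases Nat.lt_succ_iff_lt_or_eq.1 hlt with hlt | heq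
      · exact h v' hv' w' hw' hlt hadj
      · have h1 : v' = v := by
          rw [Fin.ext_iff, hv, ← heq, mul_comm, Nat.mul_add_div hn,
            Nat.div_eq_of_lt w'.2, add_zero]
        have h2 : w' = w := by
          rw [Fin.ext_iff, hw, ← heq, Nat.mul_add_mod', Nat.mod_eq_of_lt w'.2]
        subst h1; subst h2
        simp [hv', hw', hadj] at he
  · rintro _ ⟨c, rfl, hc⟩
    refine ⟨c, rfl, hc.imp_left fun ⟨h0, h⟩ => ⟨h0, fun u hu v hv => ?_⟩⟩
    exact h u hu v hv (fin_mul_add_lt u v)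

/-! ### Removal of neighbours, cardinality, maximality -/

/-- Remove the neighbours of the vertex in register `9` from the set in register `11`. -/
def removeP : Prog :=
  forP 2 (R 0) (.set 11 (R 11 - .mem (R 9 * R 0 + R 2) * bit (R 11) (R 2) * get 5 (R 2)))

theorem removeP_spec (hW : (n + 3) * (n + 3) ≤ W) {F : ℕ → ℕ → ℕ} (hs : Ctx G F s)
    {A : Finset (Fin n)} {v : Fin n} (hA : s.reg 11 = msk A) (hv : s.reg 9 = v)
    (hT : 3 * n + 2 ≤ T) :
    Reach W T removeP s fun s' =>
      s' = (s.setR 11 (msk (A.filter fun u => ¬ G.Adj v u))).setR 2 n := by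
  refine ((Reach.forP (T := 1) (one_le_of_sq_le hW) (by decide) n
    (lt_of_le_sq hW (by nlinarith)) (fun i s' => s' = (s.setR 11
      (msk (A.filter fun u => ¬ (G.Adj v u ∧ (u : ℕ) < i)))).setR 2 i)
    ?_ ?_ ?_)).mono (by omega) ?_
  · rintro i - _ rfl
    simp [hs.reg0]
  · rintro i hi _ rfl
    obtain ⟨u, rfl⟩ : ∃ u : Fin n, (u : ℕ) = i := ⟨⟨i, hi⟩, rfl⟩
    set B := A.filter fun w => ¬ (G.Adj v w ∧ (w : ℕ) < u) with hB
    have hctx : Ctx G F ((s.setR 11 (msk B)).setR 2 u) := (hs.setR (by norm_num)).setR (by norm_num)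
    have e1 : (bit (R 11) (R 2)).eval ((s.setR 11 (msk B)).setR 2 u) = if u ∈ B then 1 else 0 :=
      hctx.bit_eval (by simp) (by simp)
    have e2 : (get 5 (R 2)).eval ((s.setR 11 (msk B)).setR 2 u) = 2 ^ (u : ℕ) := by
      rw [hctx.get_eval (by norm_num), eval_R, State.setR_reg, if_pos rfl, hs.pow u u.2.le]
    refine Reach.set_last hW (v := msk (A.filter fun w => ¬ (G.Adj v w ∧ (w : ℕ) < u + 1)))
      ?_ (msk_lt_pow hW _) le_rfl (by simp)
    have e3 : (Expr.mem (R 9 * R 0 + R 2)).eval ((s.setR 11 (msk B)).setR 2 u) =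
        if G.Adj v u then 1 else 0 := by simp [hv, hs.reg0, hs.view.adj]
    have e4 : (R 11).eval ((s.setR 11 (msk B)).setR 2 u) = msk B := by simp
    rw [eval_sub, eval_mul, eval_mul, e1, e2, e3, e4]
    have hlt : ∀ w : Fin n, (w : ℕ) < u + 1 ↔ (w : ℕ) < u ∨ w = u := fun w => by
      rw [Fin.ext_iff]; omega
    by_cases hadj : G.Adj v u ∧ u ∈ B
    · rw [if_pos hadj.2, if_pos hadj.1, one_mul, one_mul, msk_erase hadj.2]
      congr 1
      ext w
      simp only [hB, mem_erase, mem_filter, hlt]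
      have := hadj.1
      by_cases hwu : w = u
      · subst hwu; simp [this]
      · simp [hwu]
    · have : (if G.Adj v u then 1 else 0) * (if u ∈ B then 1 else 0) * 2 ^ (u : ℕ) = 0 := by
        by_cases h1 : G.Adj v u
        · rw [if_neg (fun h => hadj ⟨h1, h⟩)]; simp
        · rw [if_neg h1]; simp
      rw [this, Nat.sub_zero]
      congr 1
      ext w
      simp only [hB, mem_filter, hlt]
      by_cases hwu : w = u
      · subst hwu
        simp only [hB, mem_filter, lt_irrefl, and_false, not_false_eq_true, and_true] at hadj ⊢
        tauto
      · simp [hwu]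
  · simp only [Nat.not_lt_zero, and_false, not_false_eq_true, filter_true, ← hA]
    simp only [State.ext_iff', State.setR_reg, State.setR_mem, implies_true, and_true]
    intro r; split_ifs <;> simp_all
  · rintro _ rfl
    simp

/-- Register `12` becomes the cardinality of the set in register `5`. -/
def cardP : Prog :=
  .seq (.set 12 (K 0)) (forP 2 (R 0) (.set 12 (R 12 + bit (R 5) (R 2))))

theorem cardP_spec (hW : (n + 3) * (n + 3) ≤ W) {F : ℕ → ℕ → ℕ} (hs : Ctx G F s)
    {A : Finset (Fin n)} (hA : s.reg 5 = msk A) (hT : 3 * n + 3 ≤ T) :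
    Reach W T cardP s fun s' => s' = (s.setR 12 #A).setR 2 n := by
  refine Reach.set_then hW (eval_K _ _) (by simp) (by omega) ?_
  refine ((Reach.forP (T := 1) (one_le_of_sq_le hW) (by decide) n
    (lt_of_le_sq hW (by nlinarith)) (fun i s' => s' = (s.setR 12
      #(A.filter fun u : Fin n => (u : ℕ) < i)).setR 2 i)
    ?_ ?_ (by simp))).mono (by omega) ?_
  · rintro i - _ rfl
    simp [hs.reg0]
  · rintro i hi _ rfl
    obtain ⟨u, rfl⟩ : ∃ u : Fin n, (u : ℕ) = i := ⟨⟨i, hi⟩, rfl⟩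
    have hctx : Ctx G F ((s.setR 12 #(A.filter fun w : Fin n => (w : ℕ) < u)).setR 2 u) :=
      (hs.setR (by norm_num)).setR (by norm_num)
    have e1 := hctx.bit_eval (a := R 5) (x := R 2) (A := A) (v := u) (by simp [hA]) (by simp)
    have hcard : #(A.filter fun w : Fin n => (w : ℕ) < u) + (if u ∈ A then 1 else 0) =
        #(A.filter fun w : Fin n => (w : ℕ) < u + 1) := by
      have hlt : ∀ w : Fin n, (w : ℕ) < u + 1 ↔ (w : ℕ) < u ∨ w = u := fun w => by
        rw [Fin.ext_iff]; omega
      simp only [hlt]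
      rw [filter_or, card_union_of_disjoint]
      · congr 1
        rw [filter_eq']; split_ifs <;> simp
      · rw [disjoint_filter]
        rintro x - h1 rfl; exact lt_irrefl _ h1
    refine Reach.set_last hW (v := #(A.filter fun w : Fin n => (w : ℕ) < u + 1)) ?_
      (lt_of_le_sq hW ?_) le_rfl (by simp)
    · rw [eval_add, e1, ← hcard]; simp
    · have : #(A.filter fun w : Fin n => (w : ℕ) < u + 1) ≤ n := (card_le_univ _).trans (by simp)
      nlinarith
  · rintro _ rfl
    simp

/-- Register `14` becomes `0` if no vertex can be added to the independent set in register `5`. -/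
def maximalP : Prog :=
  .seq (.set 14 (K 0)) (forP 9 (R 0)
    (.ite (bit (R 5) (R 9)) .skip
      (.seq (.set 3 (R 5 + get 5 (R 9))) (.seq conflictP (.ite (R 4) .skip (.set 14 (K 1)))))))

theorem maximalP_spec (hW : (n + 3) * (n + 3) ≤ W) {F : ℕ → ℕ → ℕ} (hs : Ctx G F s)
    {A : Finset (Fin n)} (hA : s.reg 5 = msk A) (hT : (4 * (n * n) + 8 + 2) * n + 3 ≤ T) :
    Reach W T maximalP s fun s' => s'.mem = s.mem ∧
      (∀ r, r ∉ [2, 3, 4, 9, 14] → s'.reg r = s.reg r) ∧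
      (s'.reg 14 = 0 ↔ ∀ v ∉ A, ¬ Indep G (insert v A)) := by
  refine Reach.set_then hW (eval_K _ _) (by simp) (by omega) ?_
  refine ((Reach.forP (T := 4 * (n * n) + 8) (one_le_of_sq_le hW) (by decide) n
    (lt_of_le_sq hW (by nlinarith)) (fun i s' => s'.mem = s.mem ∧
      (∀ r, r ∉ [2, 3, 4, 9, 14] → s'.reg r = s.reg r) ∧ s'.reg 9 = i ∧
      (s'.reg 14 = 0 ↔ ∀ v ∉ A, (v : ℕ) < i → ¬ Indep G (insert v A)))
    ?_ ?_ ?_)).mono (by omega) ?_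
  · rintro i - s' ⟨-, h, h9, -⟩
    exact ⟨h9, by rw [eval_R, h 0 (by simp)]; exact hs.reg0⟩
  · rintro i hi s' ⟨hm, hr, h9, h14⟩
    obtain ⟨u, rfl⟩ : ∃ u : Fin n, (u : ℕ) = i := ⟨⟨i, hi⟩, rfl⟩
    have hctx : Ctx G F s' := hs.of_same hm (hr 0 (by simp)) (hr 1 (by simp))
    have h5 : s'.reg 5 = msk A := by rw [hr 5 (by simp), hA]
    have e1 := hctx.bit_eval (a := R 5) (x := R 9) (A := A) (v := u) (by simp [h5]) (by simp [h9])
    have e2 : (get 5 (R 9)).eval s' = 2 ^ (u : ℕ) := by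
      rw [hctx.get_eval (by norm_num), eval_R, h9, hs.pow u u.2.le]
    have hlt : ∀ w : Fin n, (w : ℕ) < u + 1 ↔ (w : ℕ) < u ∨ w = u := fun w => by
      rw [Fin.ext_iff]; omega
    refine Reach.ite_of hW (by omega) ?_ ?_
    · intro he
      rw [e1] at he
      have hu : u ∈ A := by by_contra h; simp [h] at he
      refine Reach.skip_of hW (by omega) ⟨h9, by simp [hm], ?_, by simp, ?_⟩
      · intro r hr'
        rw [State.setR_reg, if_neg (by rintro rfl; simp at hr'), hr r hr']
      · rw [State.setR_reg, if_neg (by norm_num), h14]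
        refine forall_congr' fun v => forall_congr' fun hv => ?_
        rw [hlt, or_iff_left (show ¬ v = u from fun h => hv (h ▸ hu))]
    · intro he
      rw [e1] at he
      have hu : u ∉ A := by intro h; simp [h] at he
      refine Reach.set_then hW (v := msk (insert u A)) ?_ (msk_lt_pow hW _) (by omega) ?_
      · rw [eval_add, e2, eval_R, h5, msk_insert hu]
      have hctx' : Ctx G F (s'.setR 3 (msk (insert u A))) := hctx.setR (by norm_num)
      refine (conflictP_spec hW hctx' (A := insert u A) (by simp)
        le_rfl).andThen (by omega) ?_
      rintro _ ⟨c, rfl, hc⟩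
      refine Reach.ite_of hW (by omega) ?_ ?_
      · intro he'
        have hc0 : c ≠ 0 := by simpa using he'
        refine Reach.skip_of hW (by omega) ⟨by simp [h9], by simp [hm], ?_, by simp, ?_⟩
        · intro r hr'
          rw [← hr r hr']
          simp at hr'
          simp [hr']
        · simp only [State.setR_reg]
          norm_num
          rw [h14]
          have hni : ¬ Indep G (insert u A) := by
            rcases hc with hc | ⟨v, hv, w, hw, hvw, -⟩
            · exact absurd hc.1 hc0
            · exact fun h => h v hv w hw hvw
          refine forall_congr' fun v => forall_congr' fun hv => ?_
          rw [show v ≤ u ↔ (v : ℕ) < u ∨ v = u from le_iff_lt_or_eq]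
          exact ⟨fun h h' => h'.elim h fun h' => h' ▸ hni, fun h h' => h (.inl h')⟩
      · intro he'
        have hc0 : c = 0 := by simpa using he'
        refine Reach.set_last hW (eval_K _ _) (lt_of_le_sq hW (by nlinarith)) (by omega)
          ⟨by simp [h9], by simp [hm], ?_, by simp, ?_⟩
        · intro r hr'
          rw [← hr r hr']
          simp at hr'
          simp [hr']
        · simp only [State.setR_reg]
          norm_num
          refine ⟨u, hu, by omega, ?_⟩
          rcases hc with hc | ⟨v, hv, w, hw, hvw, h⟩
          · exact hc.2
          · omega
  · refine ⟨by simp, ?_, by simp, by simp⟩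
    intro r hr'
    simp at hr'
    simp [hr']
  · rintro s' ⟨hm, hr, -, h14⟩
    refine ⟨hm, hr, h14.trans ?_⟩
    exact forall_congr' fun v => forall_congr' fun hv => by simp

end GraphColoring

/-! ### Listing the good sets and all subsets of their complements -/

namespace GraphColoring

open Finset RAM

open scoped Classical

variable {n : ℕ} {G : SimpleGraph (Fin n)} {W T : ℕ} {s : State}

/-! ### The list of sets -/

/-- Array `0` holds the list `L` of sets without repetitions, array `1` marks its members. -/
structure QL (F : ℕ → ℕ → ℕ) (L : List (Finset (Fin n))) : Prop where
  entry : ∀ (i : ℕ) (h : i < L.length), F 0 i = msk L[i]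
  nodup : L.Nodup
  mark : ∀ A : Finset (Fin n), F 1 (msk A) ≠ 0 ↔ A ∈ L

theorem QL.congr {F F' : ℕ → ℕ → ℕ} {L : List (Finset (Fin n))} (h : QL F L) (h0 : F' 0 = F 0)
    (h1 : F' 1 = F 1) : QL F' L :=
  ⟨fun i hi => h0 ▸ h.entry i hi, h.nodup, fun A => h1 ▸ h.mark A⟩

theorem QL.length_le {F : ℕ → ℕ → ℕ} {L : List (Finset (Fin n))} (h : QL F L) :
    L.length ≤ 2 ^ n := by
  simpa using h.nodup.length_le_card

theorem QL.length_le_card {F : ℕ → ℕ → ℕ} {L : List (Finset (Fin n))} (h : QL F L)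
    {S : Finset (Finset (Fin n))} (hS : ∀ A ∈ L, A ∈ S) : L.length ≤ #S := by
  rw [← List.toFinset_card_of_nodup h.nodup]
  exact card_le_card fun A hA => hS A (List.mem_toFinset.1 hA)

theorem lt_pow_of_le_two_pow (hW : (n + 3) * (n + 3) ≤ W) {x : ℕ} (h : x ≤ 2 ^ n + 1) :
    x < 2 ^ W := by
  refine lt_of_le_pow hW (h.trans ?_)
  have h1 : 1 ≤ 2 ^ n := Nat.one_le_two_pow
  calc 2 ^ n + 1 ≤ 2 ^ (n + 1) := by rw [pow_succ]; omega
    _ ≤ _ := Nat.pow_le_pow_right (by norm_num) (by nlinarith)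

/-- Append the set in register `11` to the list, unless it is a member already. -/
def insertP : Prog :=
  .ite (get 1 (R 11)) .skip (.seq (put 1 (R 11) (K 1)) (.seq (put 0 (R 7) (R 11))
    (.set 7 (R 7 + K 1))))

theorem insertP_spec (hW : (n + 3) * (n + 3) ≤ W) {F : ℕ → ℕ → ℕ} (hs : Ctx G F s)
    {L : List (Finset (Fin n))} (hL : QL F L) (h7 : s.reg 7 = L.length) {A : Finset (Fin n)}
    (hA : s.reg 11 = msk A) (hT : 4 ≤ T) :
    Reach W T insertP s fun s' => ∃ F' L', Ctx G F' s' ∧ QL F' L' ∧ s'.reg 7 = L'.length ∧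
      L' = (if A ∈ L then L else L ++ [A]) ∧ (∀ c, 2 ≤ c → F' c = F c) ∧
      ∀ r, r ≠ 7 → s'.reg r = s.reg r := by
  have hmark : (get 1 (R 11)).eval s ≠ 0 ↔ A ∈ L := by
    rw [hs.get_eval (by norm_num), eval_R, hA]; exact hL.mark A
  refine Reach.ite_of hW (by omega) (fun h => ?_) (fun h => ?_)
  · refine Reach.skip_of hW (by omega) ⟨F, L, hs, hL, h7, ?_, fun _ _ => rfl, fun _ _ => rfl⟩
    rw [if_pos (hmark.1 h)]
  · have hAL : A ∉ L := fun h' => hmark.2 h' h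
    have hlen := hL.length_le
    refine Reach.put_then hW hs (by norm_num) (a := msk A) (v := 1) (by simp [hA]) rfl
      (lt_of_le_sq hW (by nlinarith)) (by omega) (fun s₁ hr₁ hc₁ => ?_)
    refine Reach.put_then hW hc₁ (by norm_num) (a := L.length) (v := msk A) (by simp [hr₁, h7])
      (by simp [hr₁, hA]) (msk_lt_pow hW _) (by omega) (fun s₂ hr₂ hc₂ => ?_)
    refine Reach.set_last hW (v := L.length + 1) (by simp [hr₂, hr₁, h7])
      (lt_pow_of_le_two_pow hW (by omega)) (by omega)
      ⟨_, L ++ [A], hc₂.setR (by norm_num), ⟨?_, ?_, ?_⟩, by simp, by rw [if_neg hAL], ?_, ?_⟩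
    · intro i hi
      rw [upd_apply, upd_of_ne (by norm_num)]
      split_ifs with h
      · subst h; simp
      · rw [List.length_append, List.length_singleton] at hi
        rw [List.getElem_append_left (by omega), hL.entry i (by omega)]
    · rw [List.nodup_append]
      refine ⟨hL.nodup, List.nodup_singleton _, ?_⟩
      rintro a ha b hb rfl
      rw [List.mem_singleton] at hb
      exact hAL (hb ▸ ha)
    · intro B
      rw [upd_of_ne (by norm_num), upd_apply, List.mem_append, List.mem_singleton]
      split_ifs with h
      · simp [msk_injective h]
      · rw [hL.mark B, or_iff_left (fun h' => h (by rw [h']))]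
    · intro c hc
      rw [upd_of_ne (by omega), upd_of_ne (by omega)]
    · intro r hr
      rw [State.setR_reg, if_neg hr, hr₂, hr₁]

/-! ### Enumeration of the good sets -/

/-- Take a set `A` from the stack. If some vertex of `A` has a neighbour in `A`, put back `A`
without this vertex, and `A` without the neighbours of this vertex. Otherwise, `A` is independent,
and its complement is listed if `A` is good. -/
def branchBody : Prog :=
  .seq (.set 6 (R 6 - K 1)) (.seq (.set 5 (get 4 (R 6))) (.seq (.set 3 (R 5)) (.seq conflictP
    (.ite (R 4)
      (.seq (.set 9 (R 4 - K 1)) (.seq (put 4 (R 6) (R 5 - get 5 (R 9))) (.seq (.set 11 (R 5))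
        (.seq removeP (.seq (put 4 (R 6 + K 1) (R 11)) (.set 6 (R 6 + K 2)))))))
      (.seq maximalP (.seq cardP
        (.ite (R 14 + (R 0 * R 0 - R 12 * (K 2 * R 1 + R 0))) .skip
          (.seq (.set 11 (get 5 (R 0) - K 1 - R 5)) insertP))))))))

/-- The state of the enumeration: the stack `st` of height `sp`, and the list `L`. -/
structure BranchInv (G : SimpleGraph (Fin n)) (F : ℕ → ℕ → ℕ) (L : List (Finset (Fin n)))
    (sp : ℕ) (st : ℕ → Finset (Fin n)) (s : State) : Prop where
  ctx : Ctx G F s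
  ql : QL F L
  reg7 : s.reg 7 = L.length
  reg6 : s.reg 6 = sp
  stack : ∀ i < sp, F 4 i = msk (st i)
  sound : ∀ A ∈ L, Good G Aᶜ
  complete : ∀ T, Good G T → Tᶜ ∈ L ∨ ∃ i < sp, T ⊆ st i

/-- The potential also bounds the height of the stack, which keeps the stack pointer within the word
length. -/
theorem sp_le_sum_pot (sp : ℕ) (st : ℕ → Finset (Fin n)) :
    sp ≤ ∑ i ∈ range sp, pot G (st i) := by
  calc sp = ∑ i ∈ range sp, 1 := by simp
    _ ≤ _ := sum_le_sum fun i _ => one_le_pot G _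

/-- The total potential of the stack is the measure: a branching node is replaced by two children of
smaller total potential, and a leaf is removed. -/
theorem branchBody_spec (hW : (n + 3) * (n + 3) ≤ W) {F : ℕ → ℕ → ℕ} {L : List (Finset (Fin n))}
    {sp : ℕ} {st : ℕ → Finset (Fin n)} (hI : BranchInv G F L (sp + 1) st s)
    (hsp : sp ≤ 2 ^ (n + 3))
    (hT : (4 * (n * n) + 8 + 2) * n + 4 * (n * n) + 3 * n + 30 ≤ T) :
    Reach W T branchBody s fun s' => ∃ F' L' sp' st', BranchInv G F' L' sp' st' s' ∧
      ∑ i ∈ range sp', pot G (st' i) < ∑ i ∈ range (sp + 1), pot G (st i) := by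
  have hs := hI.ctx
  have hsp2 : sp + 2 < 2 ^ W := by
    refine lt_of_le_pow hW ?_
    have h1 : 2 ≤ 2 ^ (n + 3) := by
      calc 2 = 2 ^ 1 := by norm_num
        _ ≤ _ := Nat.pow_le_pow_right (by norm_num) (by omega)
    calc sp + 2 ≤ 2 ^ (n + 4) := by rw [pow_succ 2 (n + 3)]; omega
      _ ≤ _ := Nat.pow_le_pow_right (by norm_num) (by nlinarith)
  set A := st sp with hAdef
  refine Reach.set_then hW (v := sp) (by simp [hI.reg6]) (by omega) (by omega) ?_
  have hs₁ : Ctx G F (s.setR 6 sp) := hs.setR (by norm_num)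
  refine Reach.set_then hW (v := msk A) ?_ (msk_lt_pow hW _) (by omega) ?_
  · rw [hs₁.get_eval (by norm_num), eval_R, State.setR_reg, if_pos rfl, hI.stack sp (by omega)]
  refine Reach.set_then hW (v := msk A) (by simp) (msk_lt_pow hW _) (by omega) ?_
  have hs₂ : Ctx G F (((s.setR 6 sp).setR 5 (msk A)).setR 3 (msk A)) :=
    (hs₁.setR (by norm_num)).setR (by norm_num)
  refine (conflictP_spec hW hs₂ (A := A) (by simp) le_rfl).andThen (by omega) ?_
  rintro _ ⟨c, rfl, hc⟩
  have hs₃ : Ctx G F (((((s.setR 6 sp).setR 5 (msk A)).setR 3 (msk A)).setR 4 c).setR 2 (n * n)) :=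
    (hs₂.setR (by norm_num)).setR (by norm_num)
  refine Reach.ite_of hW (by omega) (fun h4 => ?_) (fun h4 => ?_)
  · have hc0 : c ≠ 0 := by simpa using h4
    obtain ⟨v, hv, w, hw, hvw, rfl⟩ : ∃ v ∈ A, ∃ w ∈ A, G.Adj v w ∧ c = v + 1 := by
      rcases hc with hc | hc
      · exact absurd hc.1 hc0
      · exact hc
    have hvlt := v.2
    refine Reach.set_then hW (v := v) (by simp) (lt_of_le_sq hW (by nlinarith)) (by omega) ?_
    refine Reach.put_then hW (hs₃.setR (by norm_num)) (by norm_num) (a := sp)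
      (v := msk (A.erase v)) (by simp) ?_ (msk_lt_pow hW _) (by omega) (fun s₄ hr₄ hs₄ => ?_)
    · rw [eval_sub, (hs₃.setR (by norm_num)).get_eval (by norm_num)]
      simp [hs.pow v hvlt.le, msk_erase hv]
    refine Reach.set_then hW (v := msk A) (by simp [hr₄]) (msk_lt_pow hW _) (by omega) ?_
    refine (removeP_spec hW (hs₄.setR (by norm_num)) (A := A) (v := v) (by simp)
      (by simp [hr₄]) le_rfl).andThen (by omega) ?_
    rintro _ rfl
    refine Reach.put_then hW (((hs₄.setR (by norm_num)).setR (by norm_num)).setR (by norm_num))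
      (by norm_num) (a := sp + 1) (v := msk (A.filter fun u => ¬ G.Adj v u)) (by simp [hr₄])
      (by simp) (msk_lt_pow hW _) (by omega) (fun s₅ hr₅ hs₅ => ?_)
    refine Reach.set_last hW (v := sp + 2) (by simp [hr₅, hr₄]) hsp2 (by omega) ?_
    refine ⟨_, L, sp + 2, fun i => if i = sp then A.erase v else if i = sp + 1 then
      A.filter fun u => ¬ G.Adj v u else st i, ⟨hs₅.setR (by norm_num), ?_, ?_, by simp, ?_,
      hI.sound, ?_⟩, ?_⟩
    · refine hI.ql.congr ?_ ?_ <;> rw [upd_of_ne (by norm_num), upd_of_ne (by norm_num)]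
    · simp [hr₅, hr₄, hI.reg7]
    · intro i hi
      rw [upd_apply, upd_apply]
      rcases Nat.lt_trichotomy i sp with h | h | h
      · rw [if_neg (by omega), if_neg (by omega), if_neg (by omega), if_neg (by omega),
          hI.stack i (by omega)]
      · rw [if_neg (by omega), if_pos h, if_pos h]
      · rw [if_pos (by omega), if_neg (by omega), if_pos (by omega)]
    · intro U hU
      rcases hI.complete U hU with h | ⟨i, hi, h⟩
      · exact .inl h
      · right
        rcases Nat.lt_succ_iff_lt_or_eq.1 hi with hi | rfl
        · exact ⟨i, by omega, by rw [if_neg (by omega), if_neg (by omega)]; exact h⟩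
        -- An independent `U` inside the popped set either contains `v`, and then avoids its
        -- neighbours, or lies in the set without `v`.
        · by_cases hvU : v ∈ U
          · refine ⟨i + 1, by omega, ?_⟩
            rw [if_neg (by omega), if_pos rfl]
            exact fun u hu => mem_filter.2 ⟨h hu, hU.1 v hvU u hu⟩
          · refine ⟨i, by omega, ?_⟩
            rw [if_pos rfl]
            exact fun u hu => mem_erase.2 ⟨fun h' => hvU (h' ▸ hu), h hu⟩
    · rw [sum_range_succ, sum_range_succ, sum_range_succ (fun i => pot G (st i))]
      have h1 : ∑ i ∈ range sp, pot G (if i = sp then A.erase v else if i = sp + 1 then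
          A.filter fun u => ¬ G.Adj v u else st i) = ∑ i ∈ range sp, pot G (st i) :=
        sum_congr rfl fun i hi => by
          rw [mem_range] at hi
          rw [if_neg (by omega), if_neg (by omega)]
      rw [h1]
      beta_reduce
      rw [if_pos rfl, if_neg (by omega), if_pos rfl, ← hAdef]
      have := pot_branch hv hw hvw
      omega
  · have hc0 : c = 0 := by simpa using h4
    have hind : Indep G A := by
      rcases hc with hc | ⟨v, -, w, -, -, h⟩
      · exact hc.2
      · omega
    refine (maximalP_spec hW hs₃ (A := A) (by simp) le_rfl).andThen (by omega) ?_
    rintro s₄ ⟨hm₄, hr₄, h14⟩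
    have hs₄ : Ctx G F s₄ := hs₃.of_same hm₄ (hr₄ 0 (by simp)) (hr₄ 1 (by simp))
    refine (cardP_spec hW hs₄ (A := A) (by rw [hr₄ 5 (by simp)]; simp) le_rfl).andThen
      (by omega) ?_
    rintro _ rfl
    have hs₅ : Ctx G F ((s₄.setR 12 #A).setR 2 n) := (hs₄.setR (by norm_num)).setR (by norm_num)
    have h7 : s₄.reg 7 = L.length := by rw [hr₄ 7 (by simp)]; simp [hI.reg7]
    have h6 : s₄.reg 6 = sp := by rw [hr₄ 6 (by simp)]; simp
    have h5 : s₄.reg 5 = msk A := by rw [hr₄ 5 (by simp)]; simp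
    have hlt : ∑ i ∈ range sp, pot G (st i) < ∑ i ∈ range (sp + 1), pot G (st i) := by
      rw [sum_range_succ]
      have := one_le_pot G (st sp)
      omega
    -- The truncated difference vanishes exactly when the size condition of `Good` holds, so the sum
    -- tests maximality and size at once.
    have hgood : (R 14 + (R 0 * R 0 - R 12 * (K 2 * R 1 + R 0))).eval
        ((s₄.setR 12 #A).setR 2 n) = 0 ↔ Good G A := by
      simp only [eval_add, eval_sub, eval_mul, eval_R, eval_K, hs₅.reg0, hs₅.reg1]
      rw [Nat.add_eq_zero_iff, Nat.sub_eq_zero_iff_le, Good, ← h14, and_iff_right hind]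
      simp
    -- The popped set `A` is independent here, so a maximal independent `U ⊆ A` equals `A`; no other
    -- good set is lost with it.
    have hcomplete : ∀ U, Good G U → U = A ∨ Uᶜ ∈ L ∨ ∃ i < sp, U ⊆ st i := by
      intro U hU
      rcases hI.complete U hU with h | ⟨i, hi, h⟩
      · exact .inr (.inl h)
      · rcases Nat.lt_succ_iff_lt_or_eq.1 hi with hi | rfl
        · exact .inr (.inr ⟨i, hi, h⟩)
        · left
          by_contra hne
          obtain ⟨x, hx, hx'⟩ := exists_of_ssubset (h.ssubset_of_ne hne)
          exact hU.2.1 x hx' (hind.mono (insert_subset hx h))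
    refine Reach.ite_of hW (by omega) (fun h => ?_) (fun h => ?_)
    · have hnot : ¬ Good G A := fun h' => h (hgood.2 h')
      refine Reach.skip_of hW (by omega) ⟨F, L, sp, st, ⟨hs₅, hI.ql, by simp [h7], by simp [h6],
        fun i hi => hI.stack i (by omega), hI.sound, fun U hU => ?_⟩, hlt⟩
      exact (hcomplete U hU).resolve_left fun h' => hnot (h' ▸ hU)
    · have hA := hgood.1 h
      refine Reach.set_then hW (v := msk Aᶜ) ?_ (msk_lt_pow hW _) (by omega) ?_
      · rw [eval_sub, eval_sub, hs₅.get_eval (by norm_num), eval_R, eval_K, hs₅.reg0,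
          hs.pow n le_rfl, ← msk_compl]
        simp [h5]
      refine (insertP_spec hW (hs₅.setR (by norm_num)) hI.ql (by simp [h7]) (A := Aᶜ) (by simp)
        (by omega)).mono_post ?_
      rintro s' ⟨F', L', hs', hL', h7', hLL', hF', hr'⟩
      have hmem : ∀ B, B ∈ L' ↔ B ∈ L ∨ B = Aᶜ := by
        intro B
        rw [hLL']
        split_ifs with h
        · exact ⟨.inl, fun h' => h'.elim id fun h' => h' ▸ h⟩
        · simp
      refine ⟨F', L', sp, st, ⟨hs', hL', h7', ?_, ?_, ?_, ?_⟩, hlt⟩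
      · rw [hr' 6 (by norm_num)]; simp [h6]
      · intro i hi
        rw [hF' 4 (by norm_num), hI.stack i (by omega)]
      · intro B hB
        rcases (hmem B).1 hB with h | rfl
        · exact hI.sound B h
        · rwa [compl_compl]
      · intro U hU
        rcases hcomplete U hU with rfl | h | h
        · exact .inl ((hmem _).2 (.inr rfl))
        · exact .inl ((hmem _).2 (.inl h))
        · exact .inr h

/-- List the complements of all good sets. -/
def branchP : Prog :=
  .seq (put 4 (K 0) (get 5 (R 0) - K 1)) (.seq (.set 6 (K 1)) (.loop (R 6) branchBody))

theorem fib_le_two_pow (m : ℕ) : Nat.fib m ≤ 2 ^ m := by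
  induction m using Nat.twoStepInduction with
  | zero => simp
  | one => simp
  | more m h1 h2 =>
    rw [Nat.fib_add_two]
    rw [pow_succ] at h2 ⊢
    rw [pow_succ]
    omega

theorem branchP_spec (hW : (n + 3) * (n + 3) ≤ W) {F : ℕ → ℕ → ℕ} (hs : Ctx G F s)
    (hF : QL (n := n) F []) (h7 : s.reg 7 = 0)
    (hT : ((4 * (n * n) + 8 + 2) * n + 4 * (n * n) + 3 * n + 30 + 1) * Nat.fib (n + 3) + 3 ≤ T) :
    Reach W T branchP s fun s' => ∃ F' L, Ctx G F' s' ∧ QL F' L ∧ s'.reg 7 = L.length ∧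
      ∀ A, A ∈ L ↔ Good G Aᶜ := by
  refine Reach.put_then hW hs (by norm_num) (a := 0) (v := msk (univ : Finset (Fin n))) rfl ?_
    (msk_lt_pow hW _) (by omega) (fun s₁ hr₁ hs₁ => ?_)
  · rw [eval_sub, hs.get_eval (by norm_num), eval_R, eval_K, hs.reg0, hs.pow n le_rfl, msk_univ]
  refine Reach.set_then hW (eval_K _ _) (lt_of_le_sq hW (by nlinarith)) (by omega) ?_
  have hpot := pot_le G univ
  refine (Reach.loop (T := (4 * (n * n) + 8 + 2) * n + 4 * (n * n) + 3 * n + 30)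
    (one_le_of_sq_le hW) (by decide)
    -- The bound on the measure is carried along only to bound the stack height in each round.
    (fun m s' => m ≤ 2 ^ (n + 3) ∧ ∃ F' L sp st, BranchInv G F' L sp st s' ∧
      m = ∑ i ∈ range sp, pot G (st i)) ?_ (pot G univ) _ ⟨hpot.trans (fib_le_two_pow _), ?_⟩).mono
      ?_ ?_
  · rintro m s' ⟨hm, F', L, sp, st, hI, rfl⟩ he
    rw [eval_R, hI.reg6] at he
    obtain ⟨sp, rfl⟩ := Nat.exists_eq_succ_of_ne_zero he
    have hsp := (sp_le_sum_pot (G := G) (sp + 1) st).trans hm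
    refine (branchBody_spec hW hI (by omega) le_rfl).mono_post ?_
    rintro s'' ⟨F'', L', sp', st', hI', hlt⟩
    exact ⟨_, hlt, hlt.le.trans hm, F'', L', sp', st', hI', rfl⟩
  · refine ⟨_, [], 1, fun _ => univ, ⟨hs₁.setR (by norm_num), ?_, by simp [hr₁, h7], by simp,
      ?_, by simp, fun U _ => .inr ⟨0, by norm_num, subset_univ _⟩⟩, by simp⟩
    · exact hF.congr (upd_of_ne (by norm_num)) (upd_of_ne (by norm_num))
    · intro i hi
      rw [upd_apply, if_pos (by omega)]
  · have := Nat.mul_le_mul_left ((4 * (n * n) + 8 + 2) * n + 4 * (n * n) + 3 * n + 30 + 1) hpot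
    omega
  · rintro s' ⟨⟨m, -, F', L, sp, st, hI, -⟩, he⟩
    rw [eval_R, hI.reg6] at he
    subst he
    refine ⟨F', L, hI.ctx, hI.ql, hI.reg7, fun A => ⟨hI.sound A, fun hA => ?_⟩⟩
    rcases hI.complete _ hA with h | ⟨i, hi, -⟩
    · rwa [compl_compl] at h
    · omega

/-! ### Closure under removal of elements -/

/-- Extend the list by all subsets of its members. Register `8` keeps the old length. -/
def closeP : Prog :=
  .seq (.set 8 (R 7)) (.seq (.set 10 (K 0)) (.loop (R 7 - R 10)
    (.seq (.set 5 (get 0 (R 10))) (.seq (.set 10 (R 10 + K 1)) (forP 9 (R 0)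
      (.ite (bit (R 5) (R 9)) (.seq (.set 11 (R 5 - get 5 (R 9))) insertP) .skip))))))

/-- The state of the closure: the first `head` members of `L` have been processed. -/
structure CloseInv (G : SimpleGraph (Fin n)) (L₀ : List (Finset (Fin n))) (F : ℕ → ℕ → ℕ)
    (L : List (Finset (Fin n))) (head : ℕ) (s : State) : Prop where
  ctx : Ctx G F s
  ql : QL F L
  reg7 : s.reg 7 = L.length
  reg8 : s.reg 8 = L₀.length
  reg10 : s.reg 10 = head
  pre : L₀ <+: L
  sound : ∀ A ∈ L, ∃ B ∈ L₀, A ⊆ B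

/-- The list serves as a queue: each member is processed once and all its one-element deletions are
appended. No set outside `S` enters and there are no repetitions, so `#S - head` decreases and at
most `#S` rounds occur. -/
theorem closeP_spec (hW : (n + 3) * (n + 3) ≤ W) {F : ℕ → ℕ → ℕ} (hs : Ctx G F s)
    {L₀ : List (Finset (Fin n))} (hF : QL F L₀) (h7 : s.reg 7 = L₀.length)
    {S : Finset (Finset (Fin n))} (hS : ∀ A, A ∈ S ↔ ∃ B ∈ L₀, A ⊆ B)
    (hT : ((6 + 2) * n + 4 + 1) * #S + 3 ≤ T) :
    Reach W T closeP s fun s' => ∃ F' L, Ctx G F' s' ∧ QL F' L ∧ s'.reg 7 = L.length ∧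
      s'.reg 8 = L₀.length ∧ L₀ <+: L ∧ ∀ A, A ∈ L ↔ A ∈ S := by
  have hlen₀ := hF.length_le
  refine Reach.set_then hW (v := L₀.length) (by simp [h7]) (lt_pow_of_le_two_pow hW (by omega))
    (by omega) ?_
  refine Reach.set_then hW (eval_K _ _) (by simp) (by omega) ?_
  refine (Reach.loop (T := (6 + 2) * n + 4) (one_le_of_sq_le hW) (by decide)
    (fun m s' => ∃ F' L head, CloseInv G L₀ F' L head s' ∧ head ≤ L.length ∧
      (∀ (i : ℕ) (h : i < L.length), i < head → ∀ v ∈ L[i], L[i].erase v ∈ L) ∧ m = #S - head)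
      ?_ (#S - 0) _ ⟨F, L₀, 0, ⟨(hs.setR (by norm_num)).setR (by norm_num), hF, by simp [h7],
        by simp, by simp, List.prefix_refl _, fun A hA => ⟨A, hA, Subset.rfl⟩⟩,
        by omega, by simp, rfl⟩).mono (by rw [Nat.sub_zero]; omega) ?_
  · rintro m s₁ ⟨F₁, L, head, hI, hhead, hproc, rfl⟩ he
    simp only [eval_sub, eval_R, hI.reg7, hI.reg10] at he
    have hlt : head < L.length := by omega
    have hlenS := hI.ql.length_le_card fun A hA => (hS A).2 (hI.sound A hA)
    have hlen := hI.ql.length_le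
    set A := L[head] with hAdef
    refine Reach.set_then hW (v := msk A) ?_ (msk_lt_pow hW _) (by omega) ?_
    · rw [hI.ctx.get_eval (by norm_num), eval_R, hI.reg10, hI.ql.entry head hlt]
    refine Reach.set_then hW (v := head + 1) (by simp [hI.reg10])
      (lt_pow_of_le_two_pow hW (by omega)) (by omega) ?_
    refine ((Reach.forP (T := 6) (one_le_of_sq_le hW) (by decide) n
      (lt_of_le_sq hW (by nlinarith)) (fun i s' => ∃ F' L', CloseInv G L₀ F' L' (head + 1) s' ∧
        s'.reg 5 = msk A ∧ s'.reg 9 = i ∧ L <+: L' ∧ ∀ v ∈ A, (v : ℕ) < i → A.erase v ∈ L')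
      ?_ ?_ ?_)).mono (by omega) ?_
    · rintro i - s' ⟨F', L', hI', -, h9, -⟩
      exact ⟨h9, hI'.ctx.reg0⟩
    · rintro i hi s' ⟨F', L', hI', h5, h9, hpre, hdone⟩
      obtain ⟨u, rfl⟩ : ∃ u : Fin n, (u : ℕ) = i := ⟨⟨i, hi⟩, rfl⟩
      have e1 := hI'.ctx.bit_eval (a := R 5) (x := R 9) (A := A) (v := u) h5 h9
      refine Reach.ite_of hW (by omega) (fun h => ?_) (fun h => ?_)
      · rw [e1] at h
        have hu : u ∈ A := by by_contra h'; simp [h'] at h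
        refine Reach.set_then hW (v := msk (A.erase u)) ?_ (msk_lt_pow hW _) (by omega) ?_
        · rw [eval_sub, hI'.ctx.get_eval (by norm_num), eval_R, eval_R, h9, h5,
            hI'.ctx.pow u u.2.le, msk_erase hu]
        refine (insertP_spec hW (hI'.ctx.setR (by norm_num)) hI'.ql (by simp [hI'.reg7])
          (A := A.erase u) (by simp) (by omega)).mono_post ?_
        rintro s'' ⟨F'', L'', hs'', hL'', h7'', hLL, -, hr''⟩
        have hmem : ∀ B, B ∈ L'' ↔ B ∈ L' ∨ B = A.erase u := by
          intro B
          rw [hLL]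
          split_ifs with h
          · exact ⟨.inl, fun h' => h'.elim id fun h' => h' ▸ h⟩
          · simp
        have hpre' : L' <+: L'' := by
          rw [hLL]
          split_ifs
          · exact List.prefix_refl _
          · exact List.prefix_append _ _
        refine ⟨by rw [hr'' 9 (by norm_num)]; simp [h9], F'', L'',
          ⟨hs''.setR (by norm_num), hL'', by simp [h7''], ?_, ?_, hI'.pre.trans hpre', ?_⟩,
          ?_, by simp, hpre.trans hpre', ?_⟩
        · simp [hr'' 8 (by norm_num), hI'.reg8]
        · simp [hr'' 10 (by norm_num), hI'.reg10]
        · intro B hB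
          rcases (hmem B).1 hB with h | rfl
          · exact hI'.sound B h
          · obtain ⟨B, hB, hAB⟩ := hI.sound A (List.getElem_mem _)
            exact ⟨B, hB, (erase_subset _ _).trans hAB⟩
        · simp [hr'' 5 (by norm_num), h5]
        · intro v hv hvlt
          rcases Nat.lt_succ_iff_lt_or_eq.1 hvlt with hvlt | heq
          · exact hpre'.subset (hdone v hv hvlt)
          · rw [Fin.ext heq]
            exact (hmem _).2 (.inr rfl)
      · rw [e1] at h
        have hu : u ∉ A := fun h' => by simp [h'] at h
        refine Reach.skip_of hW (by omega) ⟨h9, F', L', ⟨hI'.ctx.setR (by norm_num), hI'.ql,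
          by simp [hI'.reg7], by simp [hI'.reg8], by simp [hI'.reg10], hI'.pre, hI'.sound⟩,
          by simp [h5], by simp, hpre, fun v hv hvlt => ?_⟩
        rcases Nat.lt_succ_iff_lt_or_eq.1 hvlt with hvlt | heq
        · exact hdone v hv hvlt
        · exact absurd hv (Fin.ext heq ▸ hu)
    · exact ⟨F₁, L, ⟨((hI.ctx.setR (by norm_num)).setR (by norm_num)).setR (by norm_num), hI.ql,
        by simp [hI.reg7], by simp [hI.reg8], by simp, hI.pre, hI.sound⟩, by simp, by simp,
        List.prefix_refl _, by simp⟩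
    · rintro s' ⟨F', L', hI', -, -, hpre, hdone⟩
      refine ⟨#S - (head + 1), by omega, F', L', head + 1, hI', hlt.trans_le hpre.length_le,
        ?_, rfl⟩
      intro i hi hi' v hv
      have hget : L'[i] = L[i]'(by omega) := (hpre.getElem (by omega)).symm
      rw [hget] at hv ⊢
      rcases Nat.lt_succ_iff_lt_or_eq.1 hi' with hi' | rfl
      · exact hpre.subset (hproc i (by omega) hi' v hv)
      · exact hdone v hv v.2
  · rintro s' ⟨⟨m, F', L, head, hI, hhead, hproc, -⟩, he⟩
    simp only [eval_sub, eval_R, hI.reg7, hI.reg10] at he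
    refine ⟨F', L, hI.ctx, hI.ql, hI.reg7, hI.reg8, hI.pre, fun A => ?_⟩
    rw [hS]
    refine ⟨hI.sound A, ?_⟩
    rintro ⟨B, hB, hAB⟩
    have hclosed : ∀ C ∈ L, ∀ v ∈ C, C.erase v ∈ L := by
      intro C hC v hv
      obtain ⟨i, hi, rfl⟩ := List.getElem_of_mem hC
      exact hproc i hi (by omega) v hv
    -- Closure under deleting one element yields closure under deleting any set, by induction on the
    -- deleted set.
    have key : ∀ (D C : Finset (Fin n)), C ∈ L → C \ D ∈ L := by
      intro D
      induction D using Finset.induction_on with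
      | empty => intro C hC; simpa using hC
      | insert v D _ ih =>
        intro C hC
        rw [sdiff_insert]
        by_cases hv : v ∈ C \ D
        · exact hclosed _ (ih C hC) v hv
        · rw [erase_eq_of_notMem hv]; exact ih C hC
    have := key (B \ A) B (hI.pre.subset hB)
    rwa [Finset.sdiff_sdiff_eq_self hAB] at this

end GraphColoring

/-! ### Zeta and Möbius transforms on the list, and the search for the least number of colours -/

namespace GraphColoring

open Finset RAM

open scoped Classical

variable {n : ℕ} {G : SimpleGraph (Fin n)} {W T : ℕ} {s : State}

/-! ### Transformations of arrays that are indexed by the members of the list -/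

/-- Array `0` holds the list `L` of length `s.reg 7`, and register `8` holds `m`. -/
structure Env (G : SimpleGraph (Fin n)) (L : List (Finset (Fin n))) (m : ℕ) (F : ℕ → ℕ → ℕ)
    (s : State) : Prop where
  ctx : Ctx G F s
  ql : QL F L
  reg7 : s.reg 7 = L.length
  reg8 : s.reg 8 = m

variable {L : List (Finset (Fin n))} {m : ℕ} {F : ℕ → ℕ → ℕ}

theorem Env.setR (h : Env G L m F s) {r v : ℕ} (h2 : 2 ≤ r) (h7 : r ≠ 7) (h8 : r ≠ 8) :
    Env G L m F (s.setR r v) :=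
  ⟨h.ctx.setR h2, h.ql, by rw [State.setR_reg, if_neg h7.symm]; exact h.reg7,
    by rw [State.setR_reg, if_neg h8.symm]; exact h.reg8⟩

theorem Env.of_same (h : Env G L m F s) {s' : State} (hm : s'.mem = s.mem)
    (hr : ∀ r ∈ [0, 1, 7, 8], s'.reg r = s.reg r) : Env G L m F s' :=
  ⟨h.ctx.of_same hm (hr 0 (by simp)) (hr 1 (by simp)), h.ql, (hr 7 (by simp)).trans h.reg7,
    (hr 8 (by simp)).trans h.reg8⟩

theorem Env.upd (h : Env G L m F s) {s' : State} {c a v : ℕ} (hc : 2 ≤ c)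
    (hs' : Ctx G (upd F c a v) s') (hr : s'.reg = s.reg) :
    Env G L m (GraphColoring.upd F c a v) s' :=
  ⟨hs', h.ql.congr (upd_of_ne (by omega)) (upd_of_ne (by omega)), hr ▸ h.reg7, hr ▸ h.reg8⟩

theorem upd_self (F : ℕ → ℕ → ℕ) (c x : ℕ) : upd F c x (F c x) = F := by
  funext c' x'
  rw [upd]
  split_ifs with h
  · rw [h.1, h.2]
  · rfl

/-- Run `body` with every member of the list in register `5`. -/
def mapP (body : Prog) : Prog := forP 10 (R 7) (.seq (.set 5 (get 0 (R 10))) body)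

/-- While member `i` is processed, array `c` holds new values at the earlier members and old ones at
the rest. The body is told this because it may read entries at other members, as the transforms do.
-/
theorem mapP_spec (hW : (n + 3) * (n + 3) ≤ W) (hE : Env G L m F s) {c : ℕ} {body : Prog}
    {Tb N : ℕ} {old new : Finset (Fin n) → ℕ} (hold : ∀ A ∈ L, F c (msk A) = old A)
    (hbody : ∀ (i : ℕ) (hi : i < L.length) (F' : ℕ → ℕ → ℕ) (s' : State), Env G L m F' s' →
      s'.reg 5 = msk L[i] → (∀ c' ≠ c, F' c' = F c') →
      (∀ A ∈ L, F' c (msk A) = if A ∈ L.take i then new A else old A) →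
      (∀ r ∈ [9, 13, 15], s'.reg r = s.reg r) →
      Reach W Tb body s' fun s'' => Env G L m (upd F' c (msk L[i]) (new L[i])) s'' ∧
        ∀ r ∈ [9, 10, 13, 15], s''.reg r = s'.reg r)
    (hN : L.length ≤ N) (hT : (Tb + 1 + 2) * N + 2 ≤ T) :
    Reach W T (mapP body) s fun s' => ∃ F', Env G L m F' s' ∧ (∀ c' ≠ c, F' c' = F c') ∧
      (∀ A ∈ L, F' c (msk A) = new A) ∧ ∀ r ∈ [9, 13, 15], s'.reg r = s.reg r := by
  have hlen := hE.ql.length_le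
  refine ((Reach.forP (T := Tb + 1) (one_le_of_sq_le hW) (by decide) L.length
    (lt_pow_of_le_two_pow hW (by omega)) (fun i s' => s'.reg 10 = i ∧ ∃ F', Env G L m F' s' ∧
      (∀ c' ≠ c, F' c' = F c') ∧ (∀ A ∈ L, F' c (msk A) = if A ∈ L.take i then new A else old A) ∧
      ∀ r ∈ [9, 13, 15], s'.reg r = s.reg r)
    ?_ ?_ ?_)).mono ?_ ?_
  · rintro i - s' ⟨h10, F', hE', -⟩
    exact ⟨h10, hE'.reg7⟩
  · rintro i hi s' ⟨h10, F', hE', hF', hval, hr⟩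
    refine Reach.set_then hW (v := msk L[i]) ?_ (msk_lt_pow hW _) (by omega) ?_
    · rw [hE'.ctx.get_eval (by norm_num), eval_R, h10, hE'.ql.entry i hi]
    refine (hbody i hi F' _ (hE'.setR (by norm_num) (by norm_num) (by norm_num)) (by simp) hF' hval
      ?_).mono (by omega) ?_
    · intro r hr'
      rw [← hr r hr']
      simp only [List.mem_cons, List.not_mem_nil, or_false] at hr'
      rw [State.setR_reg, if_neg (by omega)]
    · rintro s'' ⟨hE'', hr''⟩
      refine ⟨by rw [hr'' 10 (by simp)]; simp [h10], by simp, _,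
        hE''.setR (by norm_num) (by norm_num) (by norm_num), ?_, ?_, ?_⟩
      · intro c' hc'
        rw [upd_of_ne hc', hF' c' hc']
      · intro A hA
        have hmem : A ∈ L.take (i + 1) ↔ A ∈ L.take i ∨ A = L[i] := by
          rw [List.take_succ_eq_append_getElem hi, List.mem_append, List.mem_singleton]
        rw [upd_apply]
        simp only [hmem]
        by_cases hAi : A = L[i]
        · rw [if_pos (by rw [hAi]), if_pos (.inr hAi), hAi]
        · rw [if_neg (fun h => hAi (msk_injective h)), hval A hA]
          simp only [hAi, or_false]
      · intro r hr'
        rw [← hr r hr']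
        have h1 := hr'' r (by
          simp only [List.mem_cons, List.not_mem_nil, or_false] at hr' ⊢; omega)
        simp only [List.mem_cons, List.not_mem_nil, or_false] at hr'
        rw [State.setR_reg, if_neg (by omega), h1, State.setR_reg, if_neg (by omega)]
  · refine ⟨by simp, F, hE.setR (by norm_num) (by norm_num) (by norm_num), fun _ _ => rfl, ?_, ?_⟩
    · intro A hA
      simpa using hold A hA
    · intro r hr'
      simp only [List.mem_cons, List.not_mem_nil, or_false] at hr'
      rw [State.setR_reg, if_neg (by omega)]
  · have := Nat.mul_le_mul_left (Tb + 1 + 2) hN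
    omega
  · rintro s' ⟨-, F', hE', hF', hval, hr⟩
    refine ⟨F', hE', hF', fun A hA => ?_, hr⟩
    rw [hval A hA, List.take_length, if_pos hA]

/-- For every set of the list, array `2` says whether it is independent. -/
def indepP : Prog :=
  mapP (.seq (.set 3 (R 5)) (.seq conflictP (put 2 (R 5) (K 1 - R 4))))

theorem indepP_spec (hW : (n + 3) * (n + 3) ≤ W) (hE : Env G L m F s) {N : ℕ}
    (hN : L.length ≤ N) (hT : (4 * (n * n) + 5 + 1 + 2) * N + 2 ≤ T) :
    Reach W T indepP s fun s' => ∃ F', Env G L m F' s' ∧ ∀ A ∈ L, F' 2 (msk A) = ind G 0 A := by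
  refine (mapP_spec (c := 2) (old := fun A => F 2 (msk A)) (new := ind G 0) hW hE
    (fun _ _ => rfl) ?_ hN hT).mono_post ?_
  · intro i hi F' s' hE' h5 hF' hval hr
    refine Reach.set_then hW (v := msk L[i]) h5 (msk_lt_pow hW _) (by omega) ?_
    have hE₁ : Env G L m F' (s'.setR 3 (msk L[i])) :=
      hE'.setR (by norm_num) (by norm_num) (by norm_num)
    refine (conflictP_spec hW hE₁.ctx (A := L[i]) (by simp) le_rfl).andThen (by omega) ?_
    rintro _ ⟨c, rfl, hc⟩
    have hE₂ : Env G L m F' (((s'.setR 3 (msk L[i])).setR 4 c).setR 2 (n * n)) :=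
      (hE₁.setR (by norm_num) (by norm_num) (by norm_num)).setR (by norm_num) (by norm_num)
        (by norm_num)
    refine Reach.put_last hW hE₂.ctx (by norm_num) (a := msk L[i]) (v := ind G 0 L[i])
      (by simp [h5]) ?_ (lt_pow_of_le_two_pow hW ((ind_le G _ _).trans (by omega))) (by omega)
      (fun s₃ hr₃ hs₃ => ⟨hE₂.upd le_rfl hs₃ hr₃, fun r hr' => ?_⟩)
    · rw [ind_zero]
      rcases hc with ⟨rfl, h⟩ | ⟨v, hv, w, hw, hvw, rfl⟩
      · simp [h]
      · have : ¬ Indep G L[i] := fun h => h v hv w hw hvw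
        simp [this]
    · simp only [List.mem_cons, List.not_mem_nil, or_false] at hr'
      rw [hr₃, State.setR_reg, State.setR_reg, State.setR_reg, if_neg (by omega),
        if_neg (by omega), if_neg (by omega)]
  · rintro s' ⟨F', hE', -, h, -⟩
    exact ⟨F', hE', h⟩

/-- For every vertex `v`, combine the entry of array `c` at `A` with the entry at `A \ {v}`. -/
def layerP (o : Op) (c : ℕ) : Prog :=
  forP 9 (R 0) (mapP (.ite (bit (R 5) (R 9))
    (put c (R 5) (.op o (get c (R 5)) (get c (R 5 - get 5 (R 9))))) .skip))

theorem layerP_spec (hW : (n + 3) * (n + 3) ≤ W) (hE : Env G L m F s) {o : Op} {c : ℕ}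
    (hc : c = 2 ∨ c = 3) {h : ℕ → Finset (Fin n) → ℕ}
    (hstep : ∀ (v : Fin n) (A : Finset (Fin n)), h (v + 1) A =
      if v ∈ A then o.eval (h v A) (h v (A.erase v)) else h v A)
    (hbd : ∀ w A, h w A < 2 ^ W) (hclosed : ∀ A ∈ L, ∀ v ∈ A, A.erase v ∈ L)
    (h0 : ∀ A ∈ L, F c (msk A) = h 0 A) {N : ℕ} (hN : L.length ≤ N)
    (hT : ((2 + 1 + 2) * N + 2 + 2) * n + 2 ≤ T) :
    Reach W T (layerP o c) s fun s' => ∃ F', Env G L m F' s' ∧ (∀ c' ≠ c, F' c' = F c') ∧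
      (∀ A ∈ L, F' c (msk A) = h n A) ∧ ∀ r ∈ [13, 15], s'.reg r = s.reg r := by
  refine ((Reach.forP (T := (2 + 1 + 2) * N + 2) (one_le_of_sq_le hW) (by decide) n
    (lt_of_le_sq hW (by nlinarith)) (fun i s' => s'.reg 9 = i ∧ ∃ F', Env G L m F' s' ∧
      (∀ c' ≠ c, F' c' = F c') ∧ (∀ A ∈ L, F' c (msk A) = h i A) ∧
      ∀ r ∈ [13, 15], s'.reg r = s.reg r)
    ?_ ?_ ?_)).mono hT ?_
  · rintro i - s' ⟨h9, F', hE', -⟩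
    exact ⟨h9, hE'.ctx.reg0⟩
  · rintro i hi s' ⟨h9, F', hE', hF', hval, hr⟩
    obtain ⟨u, rfl⟩ : ∃ u : Fin n, (u : ℕ) = i := ⟨⟨i, hi⟩, rfl⟩
    refine (mapP_spec (c := c) (Tb := 2) (old := h u) (new := h (u + 1)) hW hE' hval ?_ hN
      le_rfl).mono_post ?_
    · intro i hi F'' s'' hE'' h5 hF'' hval'' hr''
      have h9'' : s''.reg 9 = u := by rw [hr'' 9 (by simp), h9]
      have e1 := hE''.ctx.bit_eval (a := R 5) (x := R 9) (A := L[i]) (v := u) h5 h9''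
      have hnot : L[i] ∉ L.take i := by
        intro hmem
        obtain ⟨j, hj, hji⟩ := List.getElem_of_mem hmem
        rw [List.getElem_take] at hji
        rw [List.length_take] at hj
        have := (hE''.ql.nodup.getElem_inj_iff (hi := by omega) (hj := hi)).1 hji
        omega
      have hcur : F'' c (msk L[i]) = h u L[i] := by
        rw [hval'' _ (List.getElem_mem _), if_neg hnot]
      refine Reach.ite_of hW (by norm_num) (fun he => ?_) (fun he => ?_)
      · rw [e1] at he
        have hu : u ∈ L[i] := by by_contra h'; simp [h'] at he
        -- The entry at a set without `u` is not changed by the pass for `u`, so its old and new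
        -- values agree. Hence the update can be done in place, whatever the order of the list.
        have herase : F'' c (msk (L[i].erase u)) = h u (L[i].erase u) := by
          rw [hval'' _ (hclosed _ (List.getElem_mem _) u hu), hstep, if_neg (notMem_erase _ _),
            ite_self]
        refine Reach.put_last hW hE''.ctx (by omega) (a := msk L[i]) (v := h (u + 1) L[i])
          h5 ?_ (hbd _ _) le_rfl (fun s₃ hr₃ hs₃ => ⟨hE''.upd (by omega) hs₃ hr₃,
            fun r _ => by rw [hr₃]⟩) (by rcases hc with rfl | rfl <;> exact Nat.le_of_ble_eq_true rfl)
        rw [hstep, if_pos hu, Expr.eval, hE''.ctx.get_eval (by omega),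
          hE''.ctx.get_eval (by omega), eval_sub, hE''.ctx.get_eval (by norm_num), eval_R, eval_R,
          h5, h9'', hE''.ctx.pow u u.2.le, msk_erase hu, hcur, herase]
      · rw [e1] at he
        have hu : u ∉ L[i] := fun h' => by simp [h'] at he
        refine Reach.skip_of hW le_rfl ⟨?_, fun _ _ => rfl⟩
        rw [hstep, if_neg hu, ← hcur, upd_self]
        exact hE''
    · rintro s'' ⟨F'', hE'', hF'', hval'', hr''⟩
      refine ⟨by rw [hr'' 9 (by simp), h9], by simp, F'',
        hE''.setR (by norm_num) (by norm_num) (by norm_num),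
        fun c' hc' => (hF'' c' hc').trans (hF' c' hc'), hval'', fun r hr' => ?_⟩
      rw [← hr r hr', ← hr'' r (List.mem_cons_of_mem _ hr')]
      simp only [List.mem_cons, List.not_mem_nil, or_false] at hr'
      rw [State.setR_reg, if_neg (by omega)]
  · refine ⟨by simp, F, hE.setR (by norm_num) (by norm_num) (by norm_num), fun _ _ => rfl, h0, ?_⟩
    intro r hr'
    simp only [List.mem_cons, List.not_mem_nil, or_false] at hr'
    rw [State.setR_reg, if_neg (by omega)]
  · rintro s' ⟨-, h⟩
    exact h

/-- Array `3` becomes the power of array `2` with the exponent in register `13`. -/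
def powP : Prog :=
  mapP (.seq (.set 12 (K 1)) (.seq (forP 2 (R 13) (.set 12 (R 12 * get 2 (R 5))))
    (put 3 (R 5) (R 12))))

theorem pow_lt_pow_of_le (hW : (n + 3) * (n + 3) ≤ W) {x k : ℕ} (hx : x ≤ 2 ^ n) (hk : k ≤ n) :
    x ^ k < 2 ^ W := by
  refine lt_of_le_pow hW ((Nat.pow_le_pow_left hx k).trans ?_)
  rw [← pow_mul]
  exact Nat.pow_le_pow_right (by norm_num) (by nlinarith)

theorem powP_spec (hW : (n + 3) * (n + 3) ≤ W) (hE : Env G L m F s) {k : ℕ} (hk : k ≤ n)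
    (h13 : s.reg 13 = k) {f : Finset (Fin n) → ℕ} (hf : ∀ A, f A ≤ 2 ^ n)
    (hF : ∀ A ∈ L, F 2 (msk A) = f A) {N : ℕ} (hN : L.length ≤ N)
    (hT : (3 * n + 4 + 1 + 2) * N + 2 ≤ T) :
    Reach W T powP s fun s' => ∃ F', Env G L m F' s' ∧ (∀ c' ≠ 3, F' c' = F c') ∧
      (∀ A ∈ L, F' 3 (msk A) = f A ^ k) ∧ ∀ r ∈ [13, 15], s'.reg r = s.reg r := by
  refine (mapP_spec (c := 3) (old := fun A => F 3 (msk A)) (new := fun A => f A ^ k) hW hE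
    (fun _ _ => rfl) ?_ hN hT).mono_post ?_
  · intro i hi F' s' hE' h5 hF' hval hr
    have h13' : s'.reg 13 = k := by rw [hr 13 (by simp), h13]
    refine Reach.set_then hW (eval_K _ _) (lt_of_le_sq hW (by nlinarith)) (by omega) ?_
    have hloop : Reach W (3 * n + 2) (forP 2 (R 13) (.set 12 (R 12 * get 2 (R 5))))
        (s'.setR 12 1) fun s'' => s'' = (s'.setR 12 (f L[i] ^ k)).setR 2 k := by
      refine (Reach.forP (T := 1) (one_le_of_sq_le hW) (by decide) k
        (lt_of_le_sq hW (by nlinarith)) (fun j s'' => s'' = (s'.setR 12 (f L[i] ^ j)).setR 2 j)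
        ?_ ?_ (by simp)).mono (by omega) fun _ h => h
      · rintro j - _ rfl
        simp [h13']
      · rintro j hj _ rfl
        refine Reach.set_last hW (v := f L[i] ^ (j + 1)) ?_ (pow_lt_pow_of_le hW (hf _) (by omega))
          le_rfl (by simp)
        rw [eval_mul, ((hE'.setR (by norm_num) (by norm_num) (by norm_num)).setR (by norm_num)
          (by norm_num) (by norm_num)).ctx.get_eval (by norm_num), hF' 2 (by norm_num)]
        simp [h5, hF L[i] (List.getElem_mem _), pow_succ]
    refine hloop.andThen (by omega) ?_
    rintro _ rfl
    have hE₂ : Env G L m F' ((s'.setR 12 (f L[i] ^ k)).setR 2 k) :=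
      (hE'.setR (by norm_num) (by norm_num) (by norm_num)).setR (by norm_num) (by norm_num)
        (by norm_num)
    refine Reach.put_last hW hE₂.ctx (by norm_num) (a := msk L[i]) (v := f L[i] ^ k)
      (by simp [h5]) (by simp) (pow_lt_pow_of_le hW (hf _) hk) (by omega)
      (fun s₃ hr₃ hs₃ => ⟨hE₂.upd (by norm_num) hs₃ hr₃, fun r hr' => ?_⟩)
    simp only [List.mem_cons, List.not_mem_nil, or_false] at hr'
    rw [hr₃, State.setR_reg, State.setR_reg, if_neg (by omega), if_neg (by omega)]
  · rintro s' ⟨F', hE', hF', h, hr⟩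
    exact ⟨F', hE', hF', h, fun r hr' => hr r (List.mem_cons_of_mem _ hr')⟩

/-- If array `3` is nonzero at one of the first members of the list (as many as register `8` says),
register `15` becomes one more than register `13`. -/
def foundP : Prog :=
  forP 10 (R 8) (.ite (get 3 (get 0 (R 10))) (.set 15 (R 13 + K 1)) .skip)

theorem foundP_spec (hW : (n + 3) * (n + 3) ≤ W) {L₀ : List (Finset (Fin n))}
    (hE : Env G L L₀.length F s) (hpre : L₀ <+: L) {k a : ℕ} (hk : k ≤ n) (h13 : s.reg 13 = k)
    (h15 : s.reg 15 = a) {N : ℕ} (hN : L.length ≤ N) (hT : (2 + 2) * N + 2 ≤ T) :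
    Reach W T foundP s fun s' => Env G L L₀.length F s' ∧ s'.reg 13 = k ∧
      s'.reg 15 = if ∃ A ∈ L₀, F 3 (msk A) ≠ 0 then k + 1 else a := by
  have hlen := hE.ql.length_le
  have hlen' := hpre.length_le
  refine ((Reach.forP (T := 2) (one_le_of_sq_le hW) (by decide) L₀.length
    (lt_pow_of_le_two_pow hW (by omega)) (fun i s' => Env G L L₀.length F s' ∧ s'.reg 10 = i ∧
      s'.reg 13 = k ∧ s'.reg 15 = if ∃ A ∈ L₀.take i, F 3 (msk A) ≠ 0 then k + 1 else a)
    ?_ ?_ ?_)).mono ?_ ?_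
  · rintro i - s' ⟨hE', h10, -⟩
    exact ⟨h10, hE'.reg8⟩
  · rintro i hi s' ⟨hE', h10, h13', h15'⟩
    have e1 : (get 3 (get 0 (R 10))).eval s' = F 3 (msk L₀[i]) := by
      rw [hE'.ctx.get_eval (by norm_num), hE'.ctx.get_eval (by norm_num), eval_R, h10,
        hE'.ql.entry i (by omega), hpre.getElem hi]
    have hex : (∃ A ∈ L₀.take (i + 1), F 3 (msk A) ≠ 0) ↔
        (∃ A ∈ L₀.take i, F 3 (msk A) ≠ 0) ∨ F 3 (msk L₀[i]) ≠ 0 := by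
      simp only [List.take_succ_eq_append_getElem hi, List.mem_append, List.mem_singleton]
      constructor
      · rintro ⟨A, h | rfl, h'⟩
        · exact .inl ⟨A, h, h'⟩
        · exact .inr h'
      · rintro (⟨A, h, h'⟩ | h')
        · exact ⟨A, .inl h, h'⟩
        · exact ⟨_, .inr rfl, h'⟩
    refine Reach.ite_of hW (by norm_num) (fun he => ?_) (fun he => ?_)
    · rw [e1] at he
      refine Reach.set_last hW (v := k + 1) (by simp [h13']) (lt_of_le_sq hW (by nlinarith)) le_rfl
        ⟨by simp [h10], (hE'.setR (by norm_num) (by norm_num) (by norm_num)).setR (by norm_num)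
          (by norm_num) (by norm_num), by simp, by simp [h13'], ?_⟩
      rw [if_pos (hex.2 (.inr he))]
      simp
    · rw [e1] at he
      refine Reach.skip_of hW le_rfl ⟨h10, hE'.setR (by norm_num) (by norm_num) (by norm_num),
        by simp, by simp [h13'], ?_⟩
      rw [State.setR_reg, if_neg (by norm_num), h15']
      simp only [hex, he, ne_eq, not_true_eq_false, or_false]
  · exact ⟨hE.setR (by norm_num) (by norm_num) (by norm_num), by simp, by simp [h13],
      by simp [h15]⟩
  · have := Nat.mul_le_mul_left (2 + 2) (hlen'.trans hN)
    omega
  · rintro s' ⟨hE', -, h13', h15'⟩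
    rw [List.take_length] at h15'
    exact ⟨hE', h13', h15'⟩

/-! ### The least number of colours -/

/-- Compute the chromatic number in register `15` from the numbers of independent subsets in
array `2`. -/
def searchP : Prog :=
  .seq (.set 15 (R 0)) (.seq (.set 13 (R 0)) (.loop (R 13)
    (.seq (.set 13 (R 13 - K 1)) (.seq powP (.seq (layerP .sub 3) foundP)))))

/-- The value `k + 1` is tested for `k` from `n - 1` down to 0, and every success overwrites
register 15, so the last one is the least. The initial value `n` is justified because `n` colours
always suffice. -/
theorem searchP_spec (hW : (n + 3) * (n + 3) ≤ W) {L₀ : List (Finset (Fin n))}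
    (hE : Env G L L₀.length F s) (hpre : L₀ <+: L) (hL₀ : ∀ A, A ∈ L₀ ↔ Good G Aᶜ)
    (hclosed : ∀ A ∈ L, ∀ v ∈ A, A.erase v ∈ L) (hF : ∀ A ∈ L, F 2 (msk A) = ind G n A)
    {N : ℕ} (hN : L.length ≤ N)
    (hT : (1 + ((3 * n + 4 + 1 + 2) * N + 2) + (((2 + 1 + 2) * N + 2 + 2) * n + 2) +
      ((2 + 2) * N + 2) + 1) * n + 3 ≤ T) :
    Reach W T searchP s fun s' => (s'.reg 15 : ℕ∞) = G.chromaticNumber ∧ s'.reg 15 ≤ n := by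
  have hfound : ∀ k, (∃ A ∈ L₀, cov G k n A ≠ 0) ↔ G.Colorable (k + 1) := by
    intro k
    rw [colorable_succ_iff]
    simp only [cov_ne_zero_iff, hL₀]
    constructor
    · rintro ⟨A, h1, h2⟩
      exact ⟨Aᶜ, h1, by rwa [compl_compl]⟩
    · rintro ⟨U, h1, h2⟩
      exact ⟨Uᶜ, by rwa [compl_compl], h2⟩
  refine Reach.set_then hW (v := n) (by simp [hE.ctx.reg0]) (lt_of_le_sq hW (by nlinarith))
    (by omega) ?_
  refine Reach.set_then hW (v := n) (by simp [hE.ctx.reg0]) (lt_of_le_sq hW (by nlinarith))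
    (by omega) ?_
  refine (Reach.loop (T := 1 + ((3 * n + 4 + 1 + 2) * N + 2) + (((2 + 1 + 2) * N + 2 + 2) * n + 2) +
      ((2 + 2) * N + 2)) (one_le_of_sq_le hW) (by decide)
    (fun k s' => ∃ F' a, Env G L L₀.length F' s' ∧ (∀ A ∈ L, F' 2 (msk A) = ind G n A) ∧
      k ≤ n ∧ s'.reg 13 = k ∧ s'.reg 15 = a ∧ a ≤ n ∧ G.Colorable a ∧
      ∀ j, k ≤ j → j < n → G.Colorable (j + 1) → a ≤ j + 1) ?_ n _
    ⟨F, n, (hE.setR (by norm_num) (by norm_num) (by norm_num)).setR (by norm_num) (by norm_num)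
      (by norm_num), hF, le_rfl, by simp, by simp, le_rfl, ?_, fun j h1 h2 => by omega⟩).mono
      (by omega) ?_
  · rintro k s' ⟨F', a, hE', hF', hk, h13, h15, han, hcol, hmin⟩ he
    rw [eval_R, h13] at he
    obtain ⟨k, rfl⟩ := Nat.exists_eq_succ_of_ne_zero he
    refine Reach.set_then hW (v := k) (by simp [h13]) (lt_of_le_sq hW (by nlinarith))
      (by omega) ?_
    refine (powP_spec hW (hE'.setR (by norm_num) (by norm_num) (by norm_num)) (k := k) (by omega)
      (by simp) (ind_le G n) hF' hN le_rfl).andThen (by omega) ?_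
    rintro s₁ ⟨F₁, hE₁, hF₁, hpow, hr₁⟩
    refine (layerP_spec hW hE₁ (o := .sub) (c := 3) (.inr rfl) (h := cov G k)
      (fun v A => cov_succ G k v A) (fun w A => ?_) hclosed (fun A hA => by rw [hpow A hA, cov_zero])
      hN le_rfl).andThen (by omega) ?_
    · refine (cov_le G k w A).trans_lt (pow_lt_pow_of_le hW le_rfl (by omega))
    rintro s₂ ⟨F₂, hE₂, hF₂, hcov, hr₂⟩
    have h13₂ : s₂.reg 13 = k := by rw [hr₂ 13 (by simp), hr₁ 13 (by simp)]; simp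
    have h15₂ : s₂.reg 15 = a := by rw [hr₂ 15 (by simp), hr₁ 15 (by simp)]; simp [h15]
    refine (foundP_spec hW hE₂ hpre (by omega) h13₂ h15₂ hN (by omega)).mono_post ?_
    rintro s₃ ⟨hE₃, h13₃, h15₃⟩
    have hiff : (∃ A ∈ L₀, F₂ 3 (msk A) ≠ 0) ↔ G.Colorable (k + 1) := by
      rw [← hfound k]
      refine exists_congr fun A => and_congr_right fun hA => ?_
      rw [hcov A (hpre.subset hA)]
    refine ⟨k, Nat.lt_succ_self _, F₂, _, hE₃, ?_, by omega, h13₃, h15₃, ?_, ?_, ?_⟩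
    · intro A hA
      rw [hF₂ 2 (by norm_num), hF₁ 2 (by norm_num), hF' A hA]
    · split_ifs
      · exact hk
      · exact han
    · split_ifs with h
      · exact hiff.1 h
      · exact hcol
    · intro j hkj hjn hj
      rcases Nat.eq_or_lt_of_le hkj with rfl | hlt
      · rw [if_pos (hiff.2 hj)]
      · split_ifs
        · omega
        · exact hmin j hlt hjn hj
  · have := SimpleGraph.colorable_of_fintype G
    rwa [Fintype.card_fin] at this
  · rintro s' ⟨⟨k, F', a, hE', -, hk, h13, h15, han, hcol, hmin⟩, he⟩
    rw [eval_R, h13] at he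
    subst he
    rw [h15]
    refine ⟨le_antisymm ?_ hcol.chromaticNumber_le, han⟩
    rw [SimpleGraph.le_chromaticNumber_iff_colorable]
    intro j hj
    rcases Nat.eq_zero_or_pos n with hn | hn
    · omega
    -- Zero colours are never tested by the loop; they are impossible since the graph has a vertex
    -- here.
    rcases j with _ | j
    · have := hj.some ⟨0, hn⟩
      exact this.elim0
    · by_cases hjn : j < n
      · exact hmin j (Nat.zero_le _) hjn hj
      · omega

end GraphColoring

/-! ### Input, assembly of the program, and its step count -/

namespace GraphColoring

open Finset RAM

open scoped Classical

variable {n : ℕ} (G : SimpleGraph (Fin n)) {W T : ℕ}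

/-! ### The input -/

theorem inputState_mem (a : ℕ) : (inputState G).mem a =
    ∑ i : Fin n, ∑ j : Fin n, if G.Adj i j ∧ (i : ℕ) * n + j = a then 1 else 0 := by
  rw [inputState]
  simp only [Finsupp.finsetSum_apply]
  refine sum_congr rfl fun i _ => sum_congr rfl fun j _ => ?_
  by_cases h : G.Adj i j
  · simp [h, Finsupp.single_apply]
  · simp [h]

theorem fin_mul_add_inj {i j i' j' : Fin n} (h : (i : ℕ) * n + j = i' * n + j') :
    i = i' ∧ j = j' := by
  have hn : 0 < n := i.pos
  have h1 := congrArg (· / n) h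
  have h2 := congrArg (· % n) h
  simp only [mul_comm _ n, Nat.mul_add_div hn, Nat.div_eq_of_lt j.2,
    Nat.div_eq_of_lt j'.2, Nat.mul_add_mod, Nat.mod_eq_of_lt j.2, Nat.mod_eq_of_lt j'.2,
    add_zero] at h1 h2
  exact ⟨Fin.ext h1, Fin.ext h2⟩

theorem inputState_mem_adj (i j : Fin n) :
    (inputState G).mem (i * n + j) = if G.Adj i j then 1 else 0 := by
  rw [inputState_mem, sum_eq_single i, sum_eq_single j]
  · simp
  · intro j' _ hj'
    rw [if_neg (fun h => hj' (fin_mul_add_inj h.2).2)]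
  · simp
  · intro i' _ hi'
    exact sum_eq_zero fun j' _ => if_neg fun h => hi' (fin_mul_add_inj h.2).1
  · simp

theorem inputState_mem_of_le {a : ℕ} (h : n * n ≤ a) : (inputState G).mem a = 0 := by
  rw [inputState_mem]
  refine sum_eq_zero fun i _ => sum_eq_zero fun j _ => if_neg fun h' => ?_
  have := fin_mul_add_lt i j
  omega

theorem exists_fin_of_lt {a : ℕ} (h : a < n * n) : ∃ i j : Fin n, (i : ℕ) * n + j = a := by
  have hn : 0 < n := Nat.pos_of_ne_zero (by rintro rfl; simp at h)
  exact ⟨⟨a / n, Nat.div_lt_of_lt_mul h⟩, ⟨a % n, Nat.mod_lt _ hn⟩, by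
    rw [mul_comm]; exact Nat.div_add_mod a n⟩

theorem inputState_mem_le (a : ℕ) : (inputState G).mem a ≤ 1 := by
  by_cases h : a < n * n
  · obtain ⟨i, j, rfl⟩ := exists_fin_of_lt h
    rw [inputState_mem_adj]
    split_ifs <;> simp
  · rw [inputState_mem_of_le G (by omega)]
    simp

theorem inputState_reg (r : ℕ) : (inputState G).reg r = if r = 0 then n else 0 := by
  rw [inputState, Finsupp.single_apply]
  simp only [eq_comm]

theorem inputState_bdd (hW : (n + 3) * (n + 3) ≤ W) : Bdd W (inputState G) := by
  refine ⟨fun r => ?_, fun a => ?_⟩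
  · rw [inputState_reg]
    split_ifs
    · exact lt_of_le_sq hW (by nlinarith)
    · simp
  · exact lt_of_le_sq hW ((inputState_mem_le G a).trans (by nlinarith))

theorem inputState_space_le : (inputState G).space ≤ (n + 2) + n * n * (n * n + 3) := by
  rw [State.space]
  refine Nat.add_le_add ?_ ?_
  · have hsub : (inputState G).reg.support ⊆ {0} := by
      intro r hr
      rw [Finsupp.mem_support_iff, inputState_reg] at hr
      rw [mem_singleton]
      by_contra h
      exact hr (if_neg h)
    refine (sum_le_sum_of_subset hsub).trans ?_
    rw [sum_singleton, inputState_reg, if_pos rfl]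
    have h1 := bitLen_le_succ 0
    have h2 := bitLen_le_succ n
    beta_reduce
    omega
  · have hsub : (inputState G).mem.support ⊆ range (n * n) := by
      intro a ha
      rw [Finsupp.mem_support_iff] at ha
      rw [mem_range]
      by_contra h
      exact ha (inputState_mem_of_le G (by omega))
    refine (sum_le_sum_of_subset hsub).trans ?_
    calc _ ≤ ∑ a ∈ range (n * n), (n * n + 3) := sum_le_sum fun a ha => by
          rw [mem_range] at ha
          have h1 := bitLen_le_succ a
          have h2 := bitLen_le_succ ((inputState G).mem a)
          have h3 := inputState_mem_le G a
          beta_reduce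
          omega
      _ = _ := by simp

/-- The ones in row `i` of the adjacency matrix are the neighbours of `i`. -/
theorem sum_inputState_mem : ∑ a ∈ range (n * n), (inputState G).mem a = degSum G := by
  rw [Finset.sum_range, ← finProdFinEquiv.sum_comp, Fintype.sum_prod_type, degSum]
  refine sum_congr rfl fun i _ => ?_
  rw [dg, card_filter]
  refine sum_congr rfl fun j _ => ?_
  rw [← inputState_mem_adj]
  congr 1
  simp [finProdFinEquiv, mul_comm, add_comm]

/-- Compute the sum of the degrees in register `1` and the powers of two in array `5`. -/
def tableP : Prog :=
  .seq (.set 1 (K 0)) (.seq (forP 2 (R 0 * R 0) (.set 1 (R 1 + .mem (R 2))))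
    (.seq (.store (cell 5 (K 0)) (K 1))
      (forP 9 (R 0) (.store (cell 5 (R 9 + K 1)) (K 2 * get 5 (R 9))))))

theorem tableP_spec (hW : (n + 3) * (n + 3) ≤ W) (hT : 3 * (n * n) + 3 * n + 6 ≤ T) :
    Reach W T tableP (inputState G) fun s' => ∃ F, Ctx G F s' ∧ (∀ c < 5, ∀ x, F c x = 0) ∧
      s'.reg 7 = 0 := by
  have hW1 := one_le_of_sq_le hW
  refine Reach.set_then hW (eval_K _ _) (by simp) (by omega) ?_
  have hsum : Reach W (3 * (n * n) + 2) (forP 2 (R 0 * R 0) (.set 1 (R 1 + .mem (R 2))))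
      ((inputState G).setR 1 0) fun s' =>
        s' = ((inputState G).setR 1 (degSum G)).setR 2 (n * n) := by
    refine (Reach.forP (T := 1) hW1 (by decide) (n * n) (lt_of_le_sq hW (by nlinarith))
      (fun i s' => s' = ((inputState G).setR 1 (∑ a ∈ range i, (inputState G).mem a)).setR 2 i)
      ?_ ?_ (by simp)).mono (by omega) ?_
    · rintro i - _ rfl
      simp [inputState_reg]
    · rintro i hi _ rfl
      refine Reach.set_last hW (v := ∑ a ∈ range (i + 1), (inputState G).mem a) ?_
        (lt_of_le_sq hW ?_) le_rfl (by simp)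
      · rw [sum_range_succ]; simp
      · calc ∑ a ∈ range (i + 1), (inputState G).mem a ≤ ∑ a ∈ range (i + 1), 1 :=
              sum_le_sum fun a _ => inputState_mem_le G a
          _ ≤ _ := by simp; nlinarith
    · rintro _ rfl
      rw [sum_inputState_mem]
  refine hsum.andThen (by omega) ?_
  rintro _ rfl
  set s₁ := ((inputState G).setR 1 (degSum G)).setR 2 (n * n) with hs₁
  -- Memory beyond the adjacency matrix is initially zero, so all six arrays start empty without
  -- initialisation.
  have hv₁ : View G (fun _ _ => 0) s₁.mem :=
    ⟨inputState_mem_adj G, fun c _ x => inputState_mem_of_le G (by omega)⟩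
  have h0 : s₁.reg 0 = n := by simp [hs₁, inputState_reg]
  refine RAM.Reach.andThen (T₁ := 1) (Q := fun s' => s'.reg = s₁.reg ∧
    View G (upd (fun _ _ => 0) 5 0 1) s'.mem) (Reach.store hW1 (by decide)
      (lt_of_le_sq (x := 1) hW (by nlinarith)) ⟨rfl, ?_⟩) (by omega) ?_
  · have hcell : (cell 5 (K 0)).eval s₁ = n * n + 6 * 0 + 5 := by simp [cell, h0]
    rw [hcell]
    exact hv₁.setM (by norm_num) 0 1
  rintro s₂ ⟨hr₂, hv₂⟩
  refine (Reach.forP (T := 1) hW1 (by decide) n (lt_of_le_sq hW (by nlinarith))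
    (fun i s' => s'.reg 0 = n ∧ s'.reg 1 = degSum G ∧ s'.reg 7 = 0 ∧ s'.reg 9 = i ∧
      ∃ F, View G F s'.mem ∧ (∀ c < 5, ∀ x, F c x = 0) ∧ ∀ v ≤ i, F 5 v = 2 ^ v)
    ?_ ?_ ⟨?_, ?_, ?_, ?_, _, hv₂, ?_, ?_⟩).mono (by omega) ?_
  · rintro i - s' ⟨h0, -, -, h9, -⟩
    exact ⟨h9, h0⟩
  · rintro i hi s' ⟨h0, h1, h7, h9, F, hv, hF, hpow⟩
    have hcell : (cell 5 (R 9 + K 1)).eval s' = n * n + 6 * (i + 1) + 5 := by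
      simp [cell, h0, h9]
    have he : (K 2 * get 5 (R 9)).eval s' = 2 ^ (i + 1) := by
      rw [eval_mul, hv.get_eval h0 (by norm_num), eval_R, h9, hpow i le_rfl, eval_K, pow_succ']
    refine Reach.store hW1 (by decide) ?_ ⟨h9, by simp [h0], by simp [h1], by simp [h7], by simp,
      upd F 5 (i + 1) (2 ^ (i + 1)), ?_, ?_, ?_⟩
    · rw [he]
      exact lt_of_le_pow hW (Nat.pow_le_pow_right (by norm_num) (by nlinarith))
    · rw [hcell, he]
      exact hv.setM (by norm_num) _ _
    · intro c hc x
      rw [upd_of_ne (by omega), hF c hc]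
    · intro v hv
      rw [upd_apply]
      split_ifs with h
      · rw [h]
      · exact hpow v (by omega)
  · simp [hr₂, h0]
  · simp [hr₂, hs₁]
  · simp [hr₂, hs₁, inputState_reg]
  · simp
  · intro c hc x
    rw [upd_of_ne (by omega)]
  · intro v hv
    obtain rfl : v = 0 := by omega
    simp [upd_apply]
  · rintro s' ⟨h0, h1, h7, -, F, hv, hF, hpow⟩
    exact ⟨F, ⟨h0, h1, hv, hpow⟩, hF, h7⟩

/-! ### The algorithm -/

/-- Compute the chromatic number. -/
def chromaticP : Prog :=
  .seq tableP (.seq branchP (.seq closeP (.seq indepP (.seq (layerP .add 2)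
    (.seq searchP (.set 0 (R 15)))))))

/-- A bound for the number of steps, in terms of the number of vertices, the size of the search
tree and the size of the family of sets. -/
def stepBound (n B N : ℕ) : ℕ :=
  (3 * (n * n) + 3 * n + 6) +
  (((4 * (n * n) + 8 + 2) * n + 4 * (n * n) + 3 * n + 30 + 1) * B + 3) +
  (((6 + 2) * n + 4 + 1) * N + 3) +
  ((4 * (n * n) + 5 + 1 + 2) * N + 2) +
  (((2 + 1 + 2) * N + 2 + 2) * n + 2) +
  ((1 + ((3 * n + 4 + 1 + 2) * N + 2) + (((2 + 1 + 2) * N + 2 + 2) * n + 2) +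
      ((2 + 2) * N + 2) + 1) * n + 3) + 1

/-- The branching phase lists the complements of good sets, so the subset closure of that list is
exactly `fam G`. This gives both the length bound for all later phases and the closure under
deletion that the transforms require. -/
theorem chromaticP_spec (hW : (n + 3) * (n + 3) ≤ W) :
    Reach W (stepBound n (Nat.fib (n + 3)) #(fam G)) chromaticP (inputState G) fun s' =>
      (s'.reg 0 : ℕ∞) = G.chromaticNumber := by
  have hT : stepBound n (Nat.fib (n + 3)) #(fam G) ≤ stepBound n (Nat.fib (n + 3)) #(fam G) :=
    le_rfl
  conv_lhs at hT => rw [stepBound]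
  set T := stepBound n (Nat.fib (n + 3)) #(fam G)
  refine (tableP_spec G hW le_rfl).andThen (by omega) ?_
  rintro s₁ ⟨F₁, hs₁, hF₁, h7₁⟩
  refine (branchP_spec hW hs₁ ⟨by simp, List.nodup_nil, fun A => by simp [hF₁ 1 (by norm_num)]⟩
    h7₁ le_rfl).andThen (by omega) ?_
  rintro s₂ ⟨F₂, L₀, hs₂, hL₀, h7₂, hgood⟩
  have hfam : ∀ A, A ∈ fam G ↔ ∃ B ∈ L₀, A ⊆ B := by
    intro A
    simp only [fam, mem_filter, mem_univ, true_and, hgood]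
    constructor
    · rintro ⟨U, hU, hAU⟩
      exact ⟨Uᶜ, by rwa [compl_compl], le_compl_iff_disjoint_right.2 hAU⟩
    · rintro ⟨B, hB, hAB⟩
      exact ⟨Bᶜ, hB, disjoint_compl_right.mono_left hAB⟩
  refine (closeP_spec hW hs₂ hL₀ h7₂ hfam le_rfl).andThen (by omega) ?_
  rintro s₃ ⟨F₃, L, hs₃, hL, h7₃, h8₃, hpre, hmem⟩
  have hE₃ : Env G L L₀.length F₃ s₃ := ⟨hs₃, hL, h7₃, h8₃⟩
  have hN : L.length ≤ #(fam G) := hL.length_le_card fun A hA => (hmem A).1 hA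
  have hclosed : ∀ A ∈ L, ∀ v ∈ A, A.erase v ∈ L := by
    intro A hA v _
    obtain ⟨B, hB, hAB⟩ := (hfam A).1 ((hmem A).1 hA)
    exact (hmem _).2 ((hfam _).2 ⟨B, hB, (erase_subset _ _).trans hAB⟩)
  refine (indepP_spec hW hE₃ hN le_rfl).andThen (by omega) ?_
  rintro s₄ ⟨F₄, hE₄, hind₄⟩
  refine (layerP_spec hW hE₄ (o := .add) (c := 2) (.inl rfl) (h := ind G) (fun v A => ind_succ G v A)
    (fun w A => lt_pow_of_le_two_pow hW ((ind_le G w A).trans (by omega))) hclosed hind₄ hN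
    le_rfl).andThen (by omega) ?_
  rintro s₅ ⟨F₅, hE₅, -, hind₅, -⟩
  refine (searchP_spec hW hE₅ hpre hgood hclosed hind₅ hN le_rfl).andThen (by omega) ?_
  rintro s₆ ⟨hχ, hle⟩
  exact Reach.set_last hW (v := s₆.reg 15) rfl (lt_of_le_sq hW (by nlinarith)) (by omega)
    (by simpa using hχ)

/-- The bound is linear in the tree size and the family size, with coefficients that are polynomials
of degree at most 3 in `n`. -/
theorem stepBound_le (n B N : ℕ) : stepBound n B N ≤ 200 * (n + 1) ^ 3 * (B + N + 1) := by
  have h1 : n ≤ (n + 1) ^ 3 := by nlinarith [sq_nonneg n]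
  have h2 : n * n ≤ (n + 1) ^ 3 := by nlinarith [sq_nonneg n]
  have h3 : n * n * n ≤ (n + 1) ^ 3 := by nlinarith [sq_nonneg n]
  have h0 : 1 ≤ (n + 1) ^ 3 := Nat.one_le_pow _ _ (Nat.succ_pos n)
  set m := (n + 1) ^ 3
  have b1 := Nat.mul_le_mul_right B h1
  have b2 := Nat.mul_le_mul_right B h2
  have b3 := Nat.mul_le_mul_right B h3
  have b0 := Nat.mul_le_mul_right B h0
  have c1 := Nat.mul_le_mul_right N h1
  have c2 := Nat.mul_le_mul_right N h2
  have c0 := Nat.mul_le_mul_right N h0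
  rw [stepBound]
  nlinarith

end GraphColoring

open GraphColoring in
/-- The average degree bounds the sum of the degrees. -/
theorem degSum_le_of_avgDegree_le {n : ℕ} (G : SimpleGraph (Fin n)) {d : ℝ}
    (h : avgDegree G ≤ d) : degSum G ≤ ⌈d⌉₊ * n := by
  classical
  rcases Nat.eq_zero_or_pos n with rfl | hn
  · simp [degSum]
  have hn' : (0 : ℝ) < n := by exact_mod_cast hn
  rw [avgDegree, div_le_iff₀ hn'] at h
  have hdeg : (∑ v : Fin n, (G.degree v : ℝ)) = degSum G := by
    rw [degSum, Nat.cast_sum]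
    refine Finset.sum_congr rfl fun v _ => ?_
    rw [dg, ← G.card_neighborFinset_eq_degree]
    congr 2
    ext u
    simp
  have h2 : (degSum G : ℝ) ≤ (⌈d⌉₊ * n : ℕ) := by
    push_cast
    calc (degSum G : ℝ) ≤ d * n := by rw [← hdeg]; convert h
      _ ≤ ⌈d⌉₊ * n := mul_le_mul_of_nonneg_right (Nat.le_ceil d) hn'.le
  exact_mod_cast h2

/-! ### Time and space in terms of the average degree -/

open GraphColoring RAM in
theorem mainTheorem1 :
    ∃ (P : RAM.Prog) (ε : ℝ → ℝ), (∀ d : ℝ, 0 < ε d ∧ ε d < 1) ∧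
      ∀ d : ℝ, ∃ (C : ℝ) (k : ℕ), ∀ (n : ℕ) (G : SimpleGraph (Fin n)), avgDegree G ≤ d →
        ∃ (s : RAM.State) (t m : ℕ), RAM.Exec P (RAM.inputState G) s t m ∧
          (s.reg 0 : ℕ∞) = G.chromaticNumber ∧
          (t : ℝ) ≤ C * ((n : ℝ) + 1) ^ k * (2 - ε d) ^ n ∧
          (m : ℝ) ≤ C * ((n : ℝ) + 1) ^ k * (2 - ε d) ^ n := by
  choose ρ hρ0 hρ1 hρ using exists_card_fam_le
  -- The base `2 - ε d` must dominate both the growth `2ρ` of the family, for the average degree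
  -- rounded up, and the growth 17/10 of the search tree.
  refine ⟨chromaticP, fun d => 2 - max (2 * ρ ⌈d⌉₊) (17 / 10), fun d => ⟨?_, ?_⟩, fun d => ?_⟩
  · have : max (2 * ρ ⌈d⌉₊) (17 / 10) < 2 := max_lt (by linarith [hρ1 ⌈d⌉₊]) (by norm_num)
    linarith
  · have := le_max_right (2 * ρ ⌈d⌉₊) (17 / 10)
    linarith
  -- The step count contributes `200 * 7` and exponent 3. The cost per step, `10000 (n+3)^2 ≤ 90000
  -- (n+1)^2`, contributes 90000 and exponent 2. The final 10 pays for the size of the input in the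
  -- space bound.
  refine ⟨200 * 7 * 90000 + 10, 5, fun n G hG => ?_⟩
  obtain ⟨s, t, m, hexec, ht, -, hχ⟩ :=
    chromaticP_spec G (W := (n + 3) * (n + 3)) le_rfl (inputState_bdd G le_rfl)
  set b : ℝ := max (2 * ρ ⌈d⌉₊) (17 / 10) with hb
  have hb1 : 17 / 10 ≤ b := le_max_right _ _
  rw [sub_sub_cancel]
  have hbn : (1 : ℝ) ≤ b ^ n := one_le_pow₀ (by linarith)
  -- The factor 5 covers `1.7 ^ 3 = 4.913`. With one `b ^ n` for the family and one for the summand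
  -- 1 it gives the 7 below.
  have hfib : (Nat.fib (n + 3) : ℝ) ≤ 5 * b ^ n := by
    refine (fib_le_pow _).trans ?_
    rw [pow_add, mul_comm]
    have := pow_le_pow_left₀ (by norm_num) hb1 n
    have h0 : (0 : ℝ) ≤ b ^ n := by linarith
    nlinarith
  have hfam : ((fam G).card : ℝ) ≤ b ^ n := by
    refine (hρ ⌈d⌉₊ n G (degSum_le_of_avgDegree_le G hG)).trans ?_
    exact pow_le_pow_left₀ (by linarith [hρ0 ⌈d⌉₊]) (le_max_left _ _) n
  have hn : (0 : ℝ) ≤ n := Nat.cast_nonneg n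
  have hn1 : (1 : ℝ) ≤ (n : ℝ) + 1 := by linarith
  have hsteps : (stepBound n (Nat.fib (n + 3)) (fam G).card : ℝ) ≤
      200 * ((n : ℝ) + 1) ^ 3 * (7 * b ^ n) := by
    have h1 : (stepBound n (Nat.fib (n + 3)) (fam G).card : ℝ) ≤
        200 * ((n : ℝ) + 1) ^ 3 * (Nat.fib (n + 3) + (fam G).card + 1) := by
      exact_mod_cast stepBound_le n (Nat.fib (n + 3)) (fam G).card
    refine h1.trans (mul_le_mul_of_nonneg_left (by linarith) (by positivity))
  have hW : (((n : ℝ) + 3) * (n + 3)) ≤ 9 * ((n : ℝ) + 1) ^ 2 := by nlinarith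
  have htime : (t : ℝ) ≤ (200 * 7 * 90000) * ((n : ℝ) + 1) ^ 5 * b ^ n := by
    have h1 : (t : ℝ) ≤ (stepBound n (Nat.fib (n + 3)) (fam G).card : ℝ) *
        (10000 * (((n : ℝ) + 3) * (n + 3))) := by exact_mod_cast ht
    calc (t : ℝ) ≤ _ := h1
      _ ≤ (200 * ((n : ℝ) + 1) ^ 3 * (7 * b ^ n)) * (10000 * (9 * ((n : ℝ) + 1) ^ 2)) := by
          gcongr
      _ = _ := by ring
  have hspace : ((inputState G).space : ℝ) ≤ 10 * ((n : ℝ) + 1) ^ 5 * b ^ n := by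
    have h1 : ((inputState G).space : ℝ) ≤ (n + 2) + n * n * (n * n + 3) := by
      exact_mod_cast inputState_space_le G
    have h2 : ((n : ℝ) + 2) + n * n * (n * n + 3) ≤ 10 * ((n : ℝ) + 1) ^ 4 := by
      nlinarith [pow_nonneg hn 2, pow_nonneg hn 3, pow_nonneg hn 4]
    have h3 : ((n : ℝ) + 1) ^ 4 ≤ ((n : ℝ) + 1) ^ 5 := pow_le_pow_right₀ hn1 (by norm_num)
    have h4 : (0 : ℝ) ≤ 10 * ((n : ℝ) + 1) ^ 5 := by positivity
    nlinarith [mul_le_mul_of_nonneg_left hbn h4]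
  have hpos : (0 : ℝ) ≤ ((n : ℝ) + 1) ^ 5 * b ^ n := by positivity
  have hm : (m : ℝ) ≤ (inputState G).space + t := by exact_mod_cast hexec.space_le.2
  refine ⟨s, t, m, hexec, hχ, ?_, ?_⟩
  · linarith
  · linarith
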